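/- Consider the synchronous anonymous message-passing model. The network is a connected simple undirected graph $G=(V,E)$ with $|V|=n\ge 2$ nodes, without failures. A node $v$ of degree $d_v$ communicates through ports $1,\dots,d_v$, each leading to exactly one neighbor; the port numberings at the nodes are arbitrary and need not be related to each other. All nodes start simultaneously and run the same randomized algorithm; initially a node knows only $n$, its degree, and an id chosen independently and uniformly at random from $\{1,\dots,n^4\}$, and it has a private source of randomness. In each round a node may send one message of $O(\log n)$ bits through each of its ports. Every node has a flag, initially $0$. Explicit leader election is solved within $T$ rounds if there is a node $\ell$ whose id differs from the ids of all other nodes such that $\ell$ has raised its flag by the end of round $T$ and keeps it raised, no other node ever raises its flag, from the end of round $T$ on every node holds the id of $\ell$ as the id of the leader, and no message is sent after round $T$. The conductance of $G$ is $$\phi=\min_{\emptyset\ne U\subsetneq V}\frac{|E(U,V\setminus U)|}{\min\{\mathrm{Vol}(U),\mathrm{Vol}(V\setminus U)\}},\qquad \mathrm{Vol}(U)=\sum_{v\in U}d_v .$$ The mixing time $t_{mix}$ of $G$ is the least $t$ such that, for every starting distribution, the distribution $\pi_t$ of the lazy random walk on $G$ (which stays put with probability $1/2$ and otherwise moves to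 a uniformly random neighbor) after $t$ steps satisfies $\|\pi_t-\pi_*\|_\infty\le \frac1{2n}$, where $\pi_*(v)=d_v/(2|E|)$. There are an algorithm (which depends on $n$ but not on any other property of $G$) and an absolute constant $C$ such that, for every $n\ge2$, every connected graph $G$ with $n$ nodes, conductance $\phi$ and mixing time $t_{mix}$, and every port numbering of $G$, with probability at least $1-1/n$ the algorithm solves explicit leader election within $C\,t_{mix}\log^2 n$ rounds and sends in total at most $$C\left(\sqrt n\,\log^{7/2} n\cdot t_{mix}+\frac{n\log n}{\phi}\right)$$ messages. -/

import Mathlib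

noncomputable section

namespace LeaderElection

/-! ### Conductance and mixing time of a finite graph -/

section Graph

variable {V : Type} [Fintype V] [DecidableEq V] (G : SimpleGraph V) [DecidableRel G.Adj]

/-- The volume of a set of nodes: the sum of their degrees. -/
def vol (U : Finset V) : ℕ := ∑ v ∈ U, G.degree v

/-- The conductance of the cut `(U, V \ U)`. The finset `G.interedges U Uᶜ` consists of the pairs
`(a, b)` of adjacent nodes with `a ∈ U` and `b ∉ U`, one for each edge that crosses the cut. -/
def cutConductance (U : Finset V) : ℝ :=
  ((G.interedges U Uᶜ).card : ℝ) / (min (vol G U) (vol G Uᶜ) : ℕ)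

/-- The conductance: the minimum of the cut conductance over all cuts with two nonempty sides. -/
def conductance : ℝ :=
  ⨅ U : {U : Finset V // U.Nonempty ∧ Uᶜ.Nonempty}, cutConductance G U.1

/-- Transition matrix of the lazy random walk; row `u` is the distribution of one step from `u`. -/
def lazyWalk : Matrix V V ℝ := Matrix.of fun u v =>
  if u = v then 1 / 2 else if G.Adj u v then 1 / (2 * (G.degree u : ℝ)) else 0

/-- The stationary distribution `d_v / (2 |E|)`. -/
def stationary (v : V) : ℝ := (G.degree v : ℝ) / (2 * (G.edgeFinset.card : ℝ))

/-- The mixing time: the least `t` such that from every starting distribution the distribution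
of the lazy walk after `t` steps is within `1 / (2n)` of the stationary one in maximum norm. -/
def mixingTime : ℕ :=
  sInf {t : ℕ | ∀ q ∈ stdSimplex ℝ V, ∀ v : V,
    |Matrix.vecMul q (lazyWalk G ^ t) v - stationary G v| ≤ 1 / (2 * (Fintype.card V : ℝ))}

/-- A port numbering: each node `v` labels its incident edges by `0, …, d_v - 1`. The labels at
the two ends of an edge are unrelated. -/
abbrev PortNumbering : Type := ∀ v : V, Fin (G.degree v) ≃ G.neighborSet v

end Graph

/-! ### Synchronous anonymous message passing with bounded messages -/

/-- The program run by every node, with messages of `L` bits. A node has access to its degree `d`,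
its randomly chosen id, its private randomness and the messages that it receives through its
ports, and to nothing else. In each round a node sends at most one message through each port
(`none` means that no message is sent), receives the messages of its neighbors, and updates its
state with a fresh sample of its private randomness. -/
structure Protocol (L : ℕ) where
  /-- local states -/
  State : Type
  /-- law of the private random sample drawn in each round by a node of degree `d` -/
  coin : (d : ℕ) → PMF ℕ
  /-- initial state of a node with given degree and id -/
  init : (d : ℕ) → (ident : ℕ) → State
  /-- messages sent through the ports -/
  send : (d : ℕ) → State → Fin d → Option (Fin L → Bool)
  /-- new state, from the old one, the received messages and the random sample -/
  step : (d : ℕ) → State → (Fin d → Option (Fin L → Bool)) → ℕ → State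
  /-- the leader flag -/
  flag : State → Bool
  /-- the id that the node believes to be that of the leader, if any -/
  leaderId : State → Option ℕ
  /-- the flag is initially down -/
  flag_init : ∀ d ident, flag (init d ident) = false

namespace Protocol

variable {L : ℕ} (A : Protocol L) {V : Type} [Fintype V] [DecidableEq V]
  (G : SimpleGraph V) [DecidableRel G.Adj] (ports : PortNumbering G)

/-- An outcome of all random choices: for each node its id and its samples of all rounds. -/
abbrev Outcome (V : Type) : Type := V → ℕ × (ℕ → ℕ)

/-- The law of the random choices: all are independent, ids are uniform in `{1, …, n ^ 4}`, and
the samples of a node of degree `d` have law `A.coin d`. -/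
def randomness : MeasureTheory.Measure (Outcome V) :=
  MeasureTheory.Measure.pi fun v : V =>
    (ProbabilityTheory.uniformOn (Set.Icc 1 (Fintype.card V ^ 4))).prod
      (MeasureTheory.Measure.infinitePi fun _ : ℕ => (A.coin (G.degree v)).toMeasure)

variable {G}

/-- The messages that `v` receives when the nodes have the states `s`: through port `i` it gets
what the neighbor `u` at the other end sends through the port of `u` that leads to `v`. -/
def inbox (s : V → A.State) (v : V) (i : Fin (G.degree v)) : Option (Fin L → Bool) :=
  A.send (G.degree (ports v i).1) (s (ports v i).1)
    ((ports (ports v i).1).symm ⟨v, SimpleGraph.Adj.symm (ports v i).2⟩)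

/-- The states of all nodes after `t` rounds. All nodes start simultaneously. -/
def run (ω : Outcome V) : ℕ → V → A.State
  | 0 => fun v => A.init (G.degree v) (ω v).1
  | t + 1 => fun v =>
      A.step (G.degree v) (run ω t v) (A.inbox ports (run ω t) v) ((ω v).2 t)

/-- The number of messages sent by all nodes in the round that follows the first `t` rounds. -/
def messages (ω : Outcome V) (t : ℕ) : ℕ :=
  ∑ v : V, (Finset.univ.filter fun i : Fin (G.degree v) =>
    (A.send (G.degree v) (A.run ports ω t v) i).isSome).card

/-- In the execution `ω` explicit leader election is solved within `T` rounds: there is a node `l`,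
the only one with its id, which has raised its flag by the end of round `T` and keeps it raised,
no other node ever raises its flag, from the end of round `T` on every node holds the id of `l` as
the id of the leader, and no message is sent after round `T`. -/
def SolvesExplicit (ω : Outcome V) (T : ℕ) : Prop :=
  (∃ l : V,
    (∀ v, (ω v).1 = (ω l).1 → v = l) ∧
    (∀ t, T ≤ t → A.flag (A.run ports ω t l) = true) ∧
    (∀ v, v ≠ l → ∀ t, A.flag (A.run ports ω t v) = false) ∧
    (∀ v t, T ≤ t → A.leaderId (A.run ports ω t v) = some (ω l).1)) ∧
  ∀ t, T ≤ t → A.messages ports ω t = 0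

end Protocol

end LeaderElection

end

noncomputable section

namespace LeaderElection

/-! ### Degrees, cuts and the conductance. -/

section Graph

set_option linter.unusedSectionVars false

open Finset

variable {V : Type} [Fintype V] [DecidableEq V] (G : SimpleGraph V) [DecidableRel G.Adj]

/-! Push-pull gossip of the largest id already meets both bounds. In each round a node asks at most
two neighbors and answers the questions of the previous round, so a round costs at most `4n`
messages (`IsExecution.sum_card_packet_le`), and it suffices to finish in `O(log n / φ)` rounds. The
messages then fit into the term `n log n / φ` alone. The time bound follows from `1 ≤ 4 t_mix φ`
(`one_le_mixingTime_mul_conductance`): a walk started in the stationary law on one side of a sparse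
cut needs about `1 / φ` steps to leave it.

Speed of gossip: for the set `S` of informed nodes, the ratio of the volumes of the complement of
`S` and of `S` shrinks in expectation by the factor `1 - φ / 4` per push-pull step
(`integral_ratio_spread_le`). It is at most `n²` at the start and at least `1 / n²` while a node is
uninformed, so Markov's inequality after `k ≥ 24 log n / φ` steps leaves probability at most `1 /
n²` of failure. One step takes three rounds, and its contacts are independent of the past
(`lintegral_potential_add_three_le`). Ids collide with probability at most `1 / n²`.

Termination: the first receptions of an id define parent pointers, and counts move along them. The
nodes counted for an id `y`, together with those that can still be counted, never exceed the number
of ids up to `y` (`IsElection.tally_le`), and for the largest id they number exactly `n`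
(`IsElection.tally_lead`). So only the owner of the largest id can collect `n`, it can do so only
when all nodes are informed, and it does so within twice the time that the spreading took. The news
then travels down the tree, since each node keeps asking its parent, and all nodes fall silent
(`IsElection.all_done`, `IsElection.packet_eq_none`). -/

/-- The number of neighbors of `v` in `A`, as a real number. -/
def degreeIn (v : V) (A : Finset V) : ℝ := ∑ w ∈ A, if G.Adj v w then 1 else 0

/-- The number of edges that leave `U`, as a real number. -/
def cutSize (U : Finset V) : ℝ := ∑ v ∈ U, degreeIn G v Uᶜ

theorem degreeIn_nonneg (v : V) (A : Finset V) : 0 ≤ degreeIn G v A :=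
  sum_nonneg fun _ _ => by split_ifs <;> norm_num

theorem degreeIn_univ (v : V) : degreeIn G v univ = G.degree v := by
  simp [degreeIn, sum_boole, ← SimpleGraph.card_neighborFinset_eq_degree,
    SimpleGraph.neighborFinset_eq_filter]

theorem degreeIn_mono (v : V) {A B : Finset V} (h : A ⊆ B) : degreeIn G v A ≤ degreeIn G v B :=
  sum_le_sum_of_subset_of_nonneg h fun _ _ _ => by split_ifs <;> norm_num

theorem degreeIn_le_degree (v : V) (A : Finset V) : degreeIn G v A ≤ G.degree v :=
  degreeIn_univ G v ▸ degreeIn_mono G v (subset_univ A)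

theorem sum_degreeIn_comm (A B : Finset V) :
    ∑ v ∈ A, degreeIn G v B = ∑ v ∈ B, degreeIn G v A := by
  simp only [degreeIn]
  rw [sum_comm]
  simp only [G.adj_comm]

theorem cutSize_compl (U : Finset V) : cutSize G Uᶜ = cutSize G U := by
  rw [cutSize, cutSize, compl_compl, sum_degreeIn_comm]

theorem card_interedges_eq_cutSize (U : Finset V) :
    ((G.interedges U Uᶜ).card : ℝ) = cutSize G U := by
  simp only [cutSize, degreeIn, SimpleGraph.interedges, Rel.interedges]
  rw [← sum_product', sum_boole]

theorem cast_vol (U : Finset V) : (vol G U : ℝ) = ∑ v ∈ U, (G.degree v : ℝ) := by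
  simp [vol]

theorem cutSize_le_vol (U : Finset V) : cutSize G U ≤ vol G U := by
  rw [cast_vol]
  exact sum_le_sum fun v _ => degreeIn_le_degree G v _

theorem vol_add_vol_compl (U : Finset V) : vol G U + vol G Uᶜ = vol G univ :=
  sum_add_sum_compl U _

theorem vol_mono {U W : Finset V} (h : U ⊆ W) : vol G U ≤ vol G W :=
  sum_le_sum_of_subset h

theorem vol_univ : vol G univ = 2 * G.edgeFinset.card :=
  G.sum_degrees_eq_twice_card_edges

theorem vol_univ_le : vol G univ ≤ Fintype.card V ^ 2 := by
  calc vol G univ ≤ ∑ _v : V, Fintype.card V :=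
        sum_le_sum fun v _ => (G.degree_lt_card_verts v).le
    _ = Fintype.card V ^ 2 := by simp [sq]

variable {G}

theorem degree_pos_of_connected (hG : G.Connected) (hV : 2 ≤ Fintype.card V) (v : V) :
    0 < G.degree v := by
  have : Nontrivial V := Fintype.one_lt_card_iff_nontrivial.1 hV
  exact hG.preconnected.degree_pos_of_nontrivial v

theorem card_le_vol (hG : G.Connected) (hV : 2 ≤ Fintype.card V) (U : Finset V) :
    #U ≤ vol G U := by
  rw [card_eq_sum_ones]
  exact sum_le_sum fun v _ => degree_pos_of_connected hG hV v

theorem vol_pos (hG : G.Connected) (hV : 2 ≤ Fintype.card V) {U : Finset V} (hU : U.Nonempty) :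
    0 < vol G U :=
  hU.card_pos.trans_le (card_le_vol hG hV U)

theorem nonempty_cuts (hV : 2 ≤ Fintype.card V) :
    Nonempty {U : Finset V // U.Nonempty ∧ Uᶜ.Nonempty} := by
  have : Nontrivial V := Fintype.one_lt_card_iff_nontrivial.1 hV
  obtain ⟨a, b, hab⟩ := exists_pair_ne V
  exact ⟨⟨{a}, ⟨a, by simp⟩, ⟨b, by simpa using hab.symm⟩⟩⟩

/-- There are finitely many cuts, so the infimum is attained; cut sizes are symmetric, so `U` can be
taken to be the side of smaller volume. -/
theorem exists_cut_eq_conductance (hV : 2 ≤ Fintype.card V) :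
    ∃ U : Finset V, U.Nonempty ∧ Uᶜ.Nonempty ∧ vol G U ≤ vol G Uᶜ ∧
      conductance G = cutSize G U / vol G U := by
  have := nonempty_cuts (V := V) hV
  obtain ⟨⟨U, h₁, h₂⟩, hU⟩ := exists_eq_ciInf_of_finite
    (f := fun U : {U : Finset V // U.Nonempty ∧ Uᶜ.Nonempty} => cutConductance G U.1)
  have hU' : conductance G = cutConductance G U := hU.symm
  rcases le_total (vol G U) (vol G Uᶜ) with h | h
  · refine ⟨U, h₁, h₂, h, ?_⟩
    rw [hU', cutConductance, card_interedges_eq_cutSize, min_eq_left h]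
  · refine ⟨Uᶜ, h₂, by rwa [compl_compl], by rwa [compl_compl], ?_⟩
    rw [hU', cutConductance, card_interedges_eq_cutSize, min_eq_right h, cutSize_compl]

theorem conductance_le_one (hV : 2 ≤ Fintype.card V) : conductance G ≤ 1 := by
  obtain ⟨U, -, -, -, h⟩ := exists_cut_eq_conductance (G := G) hV
  rw [h]
  exact div_le_one_of_le₀ (cutSize_le_vol G U) (Nat.cast_nonneg _)

theorem cutSize_pos (hG : G.Connected) {U : Finset V} (h₁ : U.Nonempty) (h₂ : Uᶜ.Nonempty) :
    0 < cutSize G U := by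
  obtain ⟨a, ha⟩ := h₁
  obtain ⟨b, hb⟩ := h₂
  obtain ⟨p⟩ := hG.preconnected a b
  obtain ⟨d, -, hd₁, hd₂⟩ := p.exists_boundary_dart (U : Set V) (by simpa using ha)
    (by simpa using hb)
  rw [cutSize]
  refine sum_pos' (fun v _ => degreeIn_nonneg G v _) ⟨d.fst, by simpa using hd₁, ?_⟩
  refine sum_pos' (fun _ _ => by split_ifs <;> norm_num) ⟨d.snd, by simpa using hd₂, ?_⟩
  simp [d.adj]

theorem conductance_pos (hG : G.Connected) (hV : 2 ≤ Fintype.card V) : 0 < conductance G := by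
  obtain ⟨U, h₁, h₂, -, h⟩ := exists_cut_eq_conductance (G := G) hV
  rw [h]
  exact div_pos (cutSize_pos hG h₁ h₂) (by exact_mod_cast vol_pos hG hV h₁)

theorem conductance_mul_le_cutSize (hG : G.Connected) (hV : 2 ≤ Fintype.card V) {U : Finset V}
    (h₁ : U.Nonempty) (h₂ : Uᶜ.Nonempty) :
    conductance G * min (vol G U : ℝ) (vol G Uᶜ) ≤ cutSize G U := by
  have h : conductance G ≤ cutConductance G U :=
    ciInf_le (Set.finite_range _).bddBelow
      (⟨U, h₁, h₂⟩ : {U : Finset V // U.Nonempty ∧ Uᶜ.Nonempty})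
  rw [cutConductance, card_interedges_eq_cutSize, Nat.cast_min] at h
  rwa [le_div_iff₀ (lt_min (by exact_mod_cast vol_pos hG hV h₁)
    (by exact_mod_cast vol_pos hG hV h₂))] at h

end Graph

/-! ### The lazy walk: convergence, and mixing time against conductance. -/

section Mixing

set_option linter.unusedSectionVars false

open Finset Matrix

variable {V : Type} [Fintype V] [DecidableEq V] {G : SimpleGraph V} [DecidableRel G.Adj]

theorem lazyWalk_nonneg (u v : V) : 0 ≤ lazyWalk G u v := by
  simp only [lazyWalk, of_apply]
  split_ifs <;> positivity

theorem lazyWalk_of_ne {u v : V} (h : u ≠ v) :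
    lazyWalk G u v = (if G.Adj u v then 1 else 0) / (2 * (G.degree u : ℝ)) := by
  simp only [lazyWalk, of_apply, if_neg h]
  split_ifs <;> simp

theorem lazyWalk_self (u : V) : lazyWalk G u u = 1 / 2 := by simp [lazyWalk]

theorem sum_lazyWalk_of_notMem {u : V} {A : Finset V} (h : u ∉ A) :
    ∑ v ∈ A, lazyWalk G u v = degreeIn G u A / (2 * (G.degree u : ℝ)) := by
  rw [degreeIn, sum_div]
  exact sum_congr rfl fun v hv => lazyWalk_of_ne fun huv => h (huv ▸ hv)

theorem sum_lazyWalk (hd : ∀ v, 0 < G.degree v) (u : V) : ∑ v, lazyWalk G u v = 1 := by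
  have h := sum_lazyWalk_of_notMem (G := G) (notMem_erase u univ)
  have h2 : degreeIn G u (univ.erase u) = G.degree u := by
    rw [← degreeIn_univ, degreeIn, degreeIn, ← add_sum_erase univ _ (mem_univ u)]
    simp
  rw [← add_sum_erase univ _ (mem_univ u), h, lazyWalk_self, h2]
  have : (G.degree u : ℝ) ≠ 0 := by exact_mod_cast (hd u).ne'
  field_simp
  norm_num

theorem degree_mul_lazyWalk (hd : ∀ v, 0 < G.degree v) (u v : V) :
    G.degree u * lazyWalk G u v = G.degree v * lazyWalk G v u := by
  rcases eq_or_ne u v with rfl | h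
  · rfl
  have h1 : (G.degree u : ℝ) ≠ 0 := by exact_mod_cast (hd u).ne'
  have h2 : (G.degree v : ℝ) ≠ 0 := by exact_mod_cast (hd v).ne'
  simp only [lazyWalk_of_ne h, lazyWalk_of_ne h.symm, G.adj_comm u v]
  field_simp

theorem sum_degree_mul_lazyWalk (hd : ∀ v, 0 < G.degree v) (v : V) :
    ∑ u, G.degree u * lazyWalk G u v = G.degree v := by
  simp_rw [degree_mul_lazyWalk hd _ v]
  rw [← mul_sum, sum_lazyWalk hd, mul_one]

theorem lazyWalk_pow_nonneg (t : ℕ) (u v : V) : 0 ≤ (lazyWalk G ^ t) u v := by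
  induction t generalizing v with
  | zero => rw [pow_zero, one_apply]; split_ifs <;> norm_num
  | succ t ih =>
    rw [pow_succ, mul_apply]
    exact sum_nonneg fun w _ => mul_nonneg (ih w) (lazyWalk_nonneg _ _)

theorem sum_lazyWalk_pow (hd : ∀ v, 0 < G.degree v) (t : ℕ) (u : V) :
    ∑ v, (lazyWalk G ^ t) u v = 1 := by
  induction t with
  | zero => simp [one_apply]
  | succ t ih =>
    simp_rw [pow_succ, mul_apply]
    rw [sum_comm]
    simp_rw [← mul_sum, sum_lazyWalk hd, mul_one, ih]

theorem stationary_vecMul_lazyWalk_pow (hd : ∀ v, 0 < G.degree v) (t : ℕ) :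
    stationary G ᵥ* lazyWalk G ^ t = stationary G := by
  induction t with
  | zero => simp
  | succ t ih =>
    rw [pow_succ, ← vecMul_vecMul, ih]
    ext v
    simp only [vecMul, dotProduct, stationary, div_mul_eq_mul_div]
    rw [← sum_div, sum_degree_mul_lazyWalk hd]

theorem stationary_eq (v : V) : stationary G v = G.degree v / vol G univ := by
  rw [stationary, vol_univ]
  push_cast
  rfl

theorem sum_stationary (U : Finset V) : ∑ v ∈ U, stationary G v = vol G U / vol G univ := by
  simp_rw [stationary_eq, ← sum_div, cast_vol]

theorem lazyWalk_pow_succ_pos {t : ℕ} {u v : V} (h : 0 < (lazyWalk G ^ t) u v) :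
    0 < (lazyWalk G ^ (t + 1)) u v := by
  rw [pow_succ, mul_apply]
  refine sum_pos' (fun w _ => mul_nonneg (lazyWalk_pow_nonneg _ _ _) (lazyWalk_nonneg _ _))
    ⟨v, mem_univ v, mul_pos h ?_⟩
  rw [lazyWalk_self]
  norm_num

theorem lazyWalk_pow_pos_mono {s t : ℕ} (hst : s ≤ t) {u v : V} (h : 0 < (lazyWalk G ^ s) u v) :
    0 < (lazyWalk G ^ t) u v := by
  induction t, hst using Nat.le_induction with
  | base => exact h
  | succ t _ ih => exact lazyWalk_pow_succ_pos ih

theorem exists_lazyWalk_pow_pos_of_reachable {u v : V} (h : G.Reachable u v) :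
    ∃ t, 0 < (lazyWalk G ^ t) u v := by
  obtain ⟨p⟩ := h
  induction p with
  | nil => exact ⟨0, by simp⟩
  | @cons a b c hab _ ih =>
    obtain ⟨t, ht⟩ := ih
    refine ⟨t + 1, ?_⟩
    rw [pow_succ', mul_apply]
    refine sum_pos' (fun w _ => mul_nonneg (lazyWalk_nonneg _ _) (lazyWalk_pow_nonneg _ _ _))
      ⟨b, mem_univ b, mul_pos ?_ ht⟩
    rw [lazyWalk_of_ne hab.ne, if_pos hab]
    have : (0 : ℝ) < G.degree a := by exact_mod_cast hab.degree_pos_left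
    positivity

/-- Laziness keeps a positive entry positive in all later powers, so the largest of the finitely
many exponents serves all pairs. -/
theorem exists_lazyWalk_pow_pos (hG : G.Connected) : ∃ t, ∀ u v, 0 < (lazyWalk G ^ t) u v := by
  choose f hf using fun p : V × V =>
    exists_lazyWalk_pow_pos_of_reachable (hG.preconnected p.1 p.2)
  exact ⟨univ.sup f, fun u v => lazyWalk_pow_pos_mono (le_sup (mem_univ (u, v))) (hf (u, v))⟩

/-- A stochastic matrix with entries at least `δ` contracts vectors of total mass zero. -/
theorem sum_abs_vecMul_le {K : Matrix V V ℝ} {δ : ℝ} (hK : ∀ u v, δ ≤ K u v)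
    (hsum : ∀ u, ∑ v, K u v = 1) {x : V → ℝ} (hx : ∑ v, x v = 0) :
    ∑ v, |(x ᵥ* K) v| ≤ (1 - Fintype.card V * δ) * ∑ v, |x v| := by
  have h1 : ∀ v, |(x ᵥ* K) v| ≤ ∑ u, |x u| * (K u v - δ) := fun v => by
    -- Since `x` has total mass zero, lowering all entries of `K` by `δ` changes nothing, and the
    -- lowered matrix has row sums `1 - |V| δ`.
    have : (x ᵥ* K) v = ∑ u, x u * (K u v - δ) := by
      simp only [mul_sub, sum_sub_distrib, ← sum_mul, hx, zero_mul, sub_zero]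
      rfl
    rw [this]
    refine (abs_sum_le_sum_abs _ _).trans (sum_le_sum fun u _ => ?_)
    rw [abs_mul, abs_of_nonneg (sub_nonneg.2 (hK u v))]
  calc ∑ v, |(x ᵥ* K) v| ≤ ∑ v, ∑ u, |x u| * (K u v - δ) := sum_le_sum fun v _ => h1 v
    _ = (1 - Fintype.card V * δ) * ∑ v, |x v| := by
      rw [sum_comm, mul_sum]
      refine sum_congr rfl fun u _ => ?_
      rw [← mul_sum, sum_sub_distrib, hsum]
      simp [mul_comm]

theorem sum_vecMul_eq {K : Matrix V V ℝ} (hsum : ∀ u, ∑ v, K u v = 1) (x : V → ℝ) :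
    ∑ v, (x ᵥ* K) v = ∑ v, x v := by
  simp only [vecMul, dotProduct]
  rw [sum_comm]
  simp_rw [← mul_sum, hsum, mul_one]

/-- The lazy walk on a connected graph mixes. -/
theorem exists_mixed (hG : G.Connected) (hV : 2 ≤ Fintype.card V) :
    ∃ t : ℕ, ∀ q ∈ stdSimplex ℝ V, ∀ v : V,
      |(q ᵥ* lazyWalk G ^ t) v - stationary G v| ≤ 1 / (2 * (Fintype.card V : ℝ)) := by
  have hd := degree_pos_of_connected hG hV
  have : Nonempty V := hG.nonempty
  obtain ⟨N, hN⟩ := exists_lazyWalk_pow_pos hG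
  set K := lazyWalk G ^ N with hKdef
  obtain ⟨p, hp⟩ := Finite.exists_min fun p : V × V => K p.1 p.2
  set δ := K p.1 p.2
  have hδ : 0 < δ := hN _ _
  have hK : ∀ u v, δ ≤ K u v := fun u v => hp (u, v)
  have hsum : ∀ u, ∑ v, K u v = 1 := sum_lazyWalk_pow hd N
  have hn : (0 : ℝ) < Fintype.card V := by exact_mod_cast (by omega : 0 < Fintype.card V)
  have hnδ : Fintype.card V * δ ≤ 1 := by
    rw [← hsum p.1, ← nsmul_eq_mul]
    exact card_nsmul_le_sum univ _ _ fun v _ => hK _ v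
  have hc0 : 0 ≤ 1 - Fintype.card V * δ := by linarith
  -- The distance to the stationary law in the sum norm is at most 2 at the start, so a contraction
  -- by `1 / (4n)` gives `1 / (2n)`.
  obtain ⟨j, hj⟩ := exists_pow_lt_of_lt_one
    (show (0 : ℝ) < 1 / (4 * Fintype.card V) by positivity)
    (show 1 - Fintype.card V * δ < 1 by nlinarith)
  have hvol : (0 : ℝ) < vol G univ := by exact_mod_cast vol_pos hG hV univ_nonempty
  refine ⟨N * j, fun q hq v => ?_⟩
  have hst : stationary G ∈ stdSimplex ℝ V :=
    ⟨fun v => by rw [stationary_eq]; positivity, by rw [sum_stationary, div_self hvol.ne']⟩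
  have hpow : ∀ i, ∑ v, ((q - stationary G) ᵥ* K ^ i) v = 0 := fun i => by
    rw [sum_vecMul_eq fun u => by rw [hKdef, ← pow_mul]; exact sum_lazyWalk_pow hd _ u]
    simp [sum_sub_distrib, hq.2, hst.2]
  have hnorm : ∀ i, ∑ v, |((q - stationary G) ᵥ* K ^ i) v| ≤
      (1 - Fintype.card V * δ) ^ i * 2 := fun i => by
    induction i with
    | zero =>
      simp only [pow_zero, vecMul_one, one_mul, Pi.sub_apply]
      calc ∑ v, |q v - stationary G v| ≤ ∑ v, (q v + stationary G v) :=
            sum_le_sum fun v _ => abs_sub_le_iff.2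
              ⟨by linarith [hst.1 v], by linarith [hq.1 v]⟩
        _ = 2 := by rw [sum_add_distrib, hq.2, hst.2]; norm_num
    | succ i ih =>
      rw [pow_succ, ← vecMul_vecMul, pow_succ', mul_assoc]
      exact (sum_abs_vecMul_le hK hsum (hpow i)).trans (mul_le_mul_of_nonneg_left ih hc0)
  have hv : (q ᵥ* lazyWalk G ^ (N * j)) v - stationary G v =
      ((q - stationary G) ᵥ* K ^ j) v := by
    rw [sub_vecMul, hKdef, ← pow_mul, stationary_vecMul_lazyWalk_pow hd]
    rfl
  rw [hv]
  calc |((q - stationary G) ᵥ* K ^ j) v| ≤ ∑ v, |((q - stationary G) ᵥ* K ^ j) v| :=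
        single_le_sum (f := fun v => |((q - stationary G) ᵥ* K ^ j) v|)
          (fun v _ => abs_nonneg _) (mem_univ v)
    _ ≤ (1 - Fintype.card V * δ) ^ j * 2 := hnorm j
    _ ≤ 1 / (4 * Fintype.card V) * 2 := by gcongr
    _ = 1 / (2 * (Fintype.card V : ℝ)) := by field_simp; norm_num

/-- The stationary distribution conditioned on `U`. -/
def stationaryOn (G : SimpleGraph V) [DecidableRel G.Adj] (U : Finset V) (v : V) : ℝ :=
  if v ∈ U then (G.degree v : ℝ) / vol G U else 0

theorem stationaryOn_mem_stdSimplex (hG : G.Connected) (hV : 2 ≤ Fintype.card V)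
    {U : Finset V} (hU : U.Nonempty) : stationaryOn G U ∈ stdSimplex ℝ V := by
  have hvol : (0 : ℝ) < vol G U := by exact_mod_cast vol_pos hG hV hU
  refine ⟨fun v => by rw [stationaryOn]; split_ifs <;> positivity, ?_⟩
  simp only [stationaryOn]
  rw [sum_ite_mem, univ_inter, ← sum_div, ← cast_vol, div_self hvol.ne']

/-- The right-hand side is a multiple of the stationary law, hence invariant, and it dominates the
starting law; a nonnegative matrix preserves the domination. -/
theorem stationaryOn_vecMul_le (hd : ∀ v, 0 < G.degree v) (U : Finset V) (t : ℕ) (v : V) :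
    (stationaryOn G U ᵥ* lazyWalk G ^ t) v ≤ G.degree v / vol G U := by
  induction t generalizing v with
  | zero =>
    rw [pow_zero, vecMul_one, stationaryOn]
    split_ifs
    · rfl
    · positivity
  | succ t ih =>
    rw [pow_succ, ← vecMul_vecMul]
    calc _ ≤ ∑ u, G.degree u / vol G U * lazyWalk G u v :=
          sum_le_sum fun u _ => mul_le_mul_of_nonneg_right (ih u) (lazyWalk_nonneg u v)
      _ = G.degree v / vol G U := by
        simp_rw [div_mul_eq_mul_div]
        rw [← sum_div, sum_degree_mul_lazyWalk hd]

/-- In each step the walk started from the stationary distribution on `U` leaves `U` with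
probability at most half the conductance of the cut. -/
theorem sum_compl_stationaryOn_vecMul_le (hd : ∀ v, 0 < G.degree v) (U : Finset V) (t : ℕ) :
    ∑ v ∈ Uᶜ, (stationaryOn G U ᵥ* lazyWalk G ^ t) v ≤ t * (cutSize G U / (2 * vol G U)) := by
  induction t with
  | zero =>
    rw [pow_zero, vecMul_one]
    refine le_of_eq ?_
    rw [Nat.cast_zero, zero_mul]
    exact sum_eq_zero fun v hv => by rw [stationaryOn, if_neg (mem_compl.1 hv)]
  | succ t ih =>
    set f := stationaryOn G U ᵥ* lazyWalk G ^ t with hf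
    have hf0 : ∀ v, 0 ≤ f v := fun v => sum_nonneg fun u _ => mul_nonneg
      (by rw [stationaryOn]; split_ifs <;> positivity) (lazyWalk_pow_nonneg _ _ _)
    have hrow : ∑ v ∈ Uᶜ, (stationaryOn G U ᵥ* lazyWalk G ^ (t + 1)) v =
        ∑ u, f u * ∑ v ∈ Uᶜ, lazyWalk G u v := by
      rw [pow_succ, ← vecMul_vecMul, ← hf]
      simp only [vecMul, dotProduct, mul_sum]
      rw [sum_comm]
    -- By the domination each edge of the cut carries at most `1 / (2 vol U)` per step; the degree
    -- of its end cancels.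
    have hin : ∑ u ∈ U, f u * ∑ v ∈ Uᶜ, lazyWalk G u v ≤ cutSize G U / (2 * vol G U) := by
      rw [cutSize, sum_div]
      refine sum_le_sum fun u hu => ?_
      rw [sum_lazyWalk_of_notMem (by simpa using hu)]
      have h1 : (0 : ℝ) < G.degree u := by exact_mod_cast hd u
      calc f u * (degreeIn G u Uᶜ / (2 * G.degree u))
          ≤ G.degree u / vol G U * (degreeIn G u Uᶜ / (2 * G.degree u)) :=
            mul_le_mul_of_nonneg_right (stationaryOn_vecMul_le hd U t u)
              (div_nonneg (degreeIn_nonneg G u _) (by positivity))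
        _ = degreeIn G u Uᶜ / (2 * vol G U) := by field_simp
    have hout : ∑ u ∈ Uᶜ, f u * ∑ v ∈ Uᶜ, lazyWalk G u v ≤ ∑ u ∈ Uᶜ, f u :=
      sum_le_sum fun u _ => mul_le_of_le_one_right (hf0 u) <| by
        rw [← sum_lazyWalk hd u]
        exact sum_le_sum_of_subset_of_nonneg (subset_univ _) fun v _ _ => lazyWalk_nonneg u v
    rw [hrow, ← sum_add_sum_compl U]
    push_cast
    linarith

/-- A mixed walk has at most the stationary mass of `U` plus `|U| / (2n)` left in `U`, so the rest
must have escaped through the cut. -/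
theorem one_sub_le_of_mixed (hG : G.Connected) (hV : 2 ≤ Fintype.card V) {t : ℕ}
    (ht : ∀ q ∈ stdSimplex ℝ V, ∀ v : V,
      |(q ᵥ* lazyWalk G ^ t) v - stationary G v| ≤ 1 / (2 * (Fintype.card V : ℝ)))
    {U : Finset V} (hU : U.Nonempty) :
    1 - vol G U / vol G univ - #U / (2 * (Fintype.card V : ℝ)) ≤
      t * (cutSize G U / (2 * vol G U)) := by
  have hd := degree_pos_of_connected hG hV
  have h1 : ∑ v, (stationaryOn G U ᵥ* lazyWalk G ^ t) v = 1 := by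
    rw [sum_vecMul_eq (sum_lazyWalk_pow hd t), (stationaryOn_mem_stdSimplex hG hV hU).2]
  have h2 : ∑ v ∈ U, (stationaryOn G U ᵥ* lazyWalk G ^ t) v ≤
      ∑ v ∈ U, (stationary G v + 1 / (2 * (Fintype.card V : ℝ))) :=
    sum_le_sum fun v _ => by
      linarith [(abs_le.1 (ht _ (stationaryOn_mem_stdSimplex hG hV hU) v)).2]
  rw [sum_add_distrib, sum_stationary, sum_const, nsmul_eq_mul, mul_one_div] at h2
  rw [← sum_add_sum_compl U] at h1
  linarith [sum_compl_stationaryOn_vecMul_le hd U t]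

/-- The mixing time is at least of the order of the inverse conductance. -/
theorem one_le_mixingTime_mul_conductance (hG : G.Connected) (hV : 2 ≤ Fintype.card V) :
    1 ≤ 4 * mixingTime G * conductance G := by
  -- Without `exists_mixed` the infimum could be that of the empty set, which is 0.
  have ht := Nat.sInf_mem (exists_mixed hG hV)
  change ∀ q ∈ stdSimplex ℝ V, ∀ v : V, |(q ᵥ* lazyWalk G ^ mixingTime G) v - stationary G v| ≤
    1 / (2 * (Fintype.card V : ℝ)) at ht
  set t := mixingTime G
  obtain ⟨U, hU, hU', hle, hφ⟩ := exists_cut_eq_conductance (G := G) hV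
  have a1 := one_sub_le_of_mixed hG hV ht hU
  have a2 := one_sub_le_of_mixed hG hV ht hU'
  have hv1 : (0 : ℝ) < vol G U := by exact_mod_cast vol_pos hG hV hU
  have hv2 : (0 : ℝ) < vol G Uᶜ := by exact_mod_cast vol_pos hG hV hU'
  have hle' : (vol G U : ℝ) ≤ vol G Uᶜ := by exact_mod_cast hle
  have hadd : (vol G U : ℝ) + vol G Uᶜ = vol G univ := by exact_mod_cast vol_add_vol_compl G U
  have hcard : (#U : ℝ) + #Uᶜ = Fintype.card V := by exact_mod_cast card_add_card_compl U
  have hc := (cutSize_pos hG hU hU').le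
  have b1 : cutSize G U / (2 * vol G U) = conductance G / 2 := by rw [hφ]; field_simp
  have b2 : cutSize G Uᶜ / (2 * vol G Uᶜ) ≤ conductance G / 2 := by
    rw [cutSize_compl, ← b1]
    gcongr
  have b3 : (t : ℝ) * (cutSize G Uᶜ / (2 * vol G Uᶜ)) ≤ t * (conductance G / 2) := by gcongr
  rw [b1] at a1
  have hn : (0 : ℝ) < Fintype.card V := by exact_mod_cast (by omega : 0 < Fintype.card V)
  have c1 : (vol G U : ℝ) / vol G univ + vol G Uᶜ / vol G univ = 1 := by
    rw [← add_div, hadd, div_self (by linarith)]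
  have c2 : (#U : ℝ) / (2 * Fintype.card V) + #Uᶜ / (2 * Fintype.card V) = 1 / 2 := by
    rw [← add_div, hcard]; field_simp
  have c3 : (0 : ℝ) ≤ #U / (2 * Fintype.card V) := by positivity
  have c4 : (0 : ℝ) ≤ #Uᶜ / (2 * Fintype.card V) := by positivity
  have c5 : (vol G U : ℝ) / vol G univ ≤ vol G Uᶜ / vol G univ := by gcongr
  -- The error `|U| / (2n)` can come close to `1/2`, so the side `U` alone does not suffice. If `U`
  -- has volume fraction above `3/8` and more than half of the nodes, its complement has fraction at
  -- most `5/8` and at most half of the nodes. In every case at least `1/8` escapes, whence the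
  -- factor 4.
  rcases le_total ((vol G U : ℝ) / vol G univ) (3 / 8) with h | h
  · linarith
  · rcases le_total ((#U : ℝ) / (2 * Fintype.card V)) (1 / 4) with h' | h' <;> linarith

end Mixing

/-! ### The gossip protocol -/

/-- The content of a message. -/
structure Packet where
  /-- the largest id known to the sender -/
  best : ℕ
  /-- the part of the count that is handed over to the receiver -/
  mass : ℕ
  /-- whether the sender wants a reply -/
  ask : Bool
  /-- whether the sender knows that the election is over -/
  done : Bool

/-- The state of a node. -/
structure NodeState where
  /-- the largest id known to the node -/
  best : ℕ
  /-- the number of nodes counted on behalf of `best` and held at this node -/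
  mass : ℕ
  /-- the port through which `best` was first received -/
  parent : Option ℕ
  /-- the random port to be contacted -/
  contact : Option ℕ
  /-- the ports to be replied to -/
  askers : Finset ℕ
  /-- whether the node knows that the election is over -/
  done : Bool

namespace NodeState

open Finset Classical

/-- The initial state. -/
def initial (ident : ℕ) : NodeState := ⟨ident, 1, none, none, ∅, false⟩

/-- The node asks for a reply through port `i`. -/
def Asks (s : NodeState) (i : ℕ) : Prop :=
  s.done = false ∧ (s.contact = some i ∨ s.parent = some i)

/-- The node hands over its count through port `i`. -/
def Forwards (s : NodeState) (i : ℕ) : Prop := s.done = false ∧ s.parent = some i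

/-- The message sent through port `i` in a network of `n` nodes. -/
def packet (n : ℕ) (s : NodeState) (i : ℕ) : Option Packet :=
  if s.Asks i ∨ i ∈ s.askers then
    -- The truncations keep every packet in the range of the code, whatever the ids are. In an
    -- election they change nothing, by `min_best` and `mass_le`.
    some ⟨min s.best (n ^ 4), if s.Forwards i then min s.mass n else 0, decide (s.Asks i), s.done⟩
  else none

/-- The part of the count that is not handed over. -/
def kept (s : NodeState) : ℕ := if s.done = true ∨ s.parent = none then s.mass else 0

variable {d : ℕ}

/-- The id received through port `i`, and `0` if there is none. -/
def heard (inb : Fin d → Option Packet) (i : Fin d) : ℕ := (inb i).elim 0 Packet.best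

/-- The total count received on behalf of the id `b`. -/
def received (b : ℕ) (inb : Fin d → Option Packet) : ℕ :=
  ∑ i, (inb i).elim 0 fun p => if p.best = b then p.mass else 0

/-- Port `i` delivers the largest received id, and this id is new. -/
def Adopts (s : NodeState) (inb : Fin d → Option Packet) (i : Fin d) : Prop :=
  s.best < heard inb i ∧ ∀ j, heard inb j ≤ heard inb i

/-- The new largest id, count and parent. -/
def update (s : NodeState) (inb : Fin d → Option Packet) : ℕ × ℕ × Option ℕ :=
  if h : ∃ i, s.Adopts inb i then (heard inb h.choose, 1, some h.choose)
  else (s.best, s.kept + received s.best inb, s.parent)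

/-- The new state after a round in a network of `n` nodes. -/
def advance (n : ℕ) (s : NodeState) (inb : Fin d → Option Packet) (coin : ℕ) : NodeState where
  best := (s.update inb).1
  mass := (s.update inb).2.1
  parent := (s.update inb).2.2
  contact := some coin
  askers := ({i | ∃ p, inb i = some p ∧ p.ask = true} : Finset (Fin d)).image Fin.val
  done := decide (s.done = true ∨ (∃ i p, inb i = some p ∧ p.done = true) ∨
    ((s.update inb).2.2 = none ∧ (s.update inb).2.1 = n))

variable {n : ℕ} {s : NodeState} {inb : Fin d → Option Packet} {coin : ℕ}

/-- This hides the choice of the adopting port. If some received id is new, then a port with the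
largest received id adopts, so without adoption nothing larger was heard. -/
theorem advance_cases (n : ℕ) (s : NodeState) (inb : Fin d → Option Packet) (coin : ℕ) :
    (∃ i, s.Adopts inb i ∧ (s.advance n inb coin).best = heard inb i ∧
      (s.advance n inb coin).mass = 1 ∧ (s.advance n inb coin).parent = some (i : ℕ)) ∨
    ((∀ i, heard inb i ≤ s.best) ∧ (s.advance n inb coin).best = s.best ∧
      (s.advance n inb coin).mass = s.kept + received s.best inb ∧
      (s.advance n inb coin).parent = s.parent) := by
  by_cases h : ∃ i, s.Adopts inb i
  · exact Or.inl ⟨h.choose, h.choose_spec, by simp [advance, update, h]⟩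
  · refine Or.inr ⟨fun i => ?_, by simp [advance, update, h]⟩
    by_contra! hi
    obtain ⟨j, -, hj⟩ := exists_max_image univ (heard inb) ⟨i, mem_univ i⟩
    exact h ⟨j, hi.trans_le (hj i (mem_univ i)), fun k => hj k (mem_univ k)⟩

theorem best_le_advance : s.best ≤ (s.advance n inb coin).best := by
  rcases advance_cases n s inb coin with ⟨i, hi, h, -⟩ | ⟨-, h, -⟩ <;> rw [h]
  exact hi.1.le

theorem heard_le_advance (i : Fin d) : heard inb i ≤ (s.advance n inb coin).best := by
  rcases advance_cases n s inb coin with ⟨j, hj, h, -⟩ | ⟨h', h, -⟩ <;> rw [h]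
  exacts [hj.2 i, h' i]

theorem done_advance : (s.advance n inb coin).done = true ↔
    s.done = true ∨ (∃ i p, inb i = some p ∧ p.done = true) ∨
      ((s.advance n inb coin).parent = none ∧ (s.advance n inb coin).mass = n) := by
  simp [advance]

theorem mem_askers_advance (i : Fin d) : (i : ℕ) ∈ (s.advance n inb coin).askers ↔
    ∃ p, inb i = some p ∧ p.ask = true := by
  simp [advance, Fin.val_inj]

theorem packet_eq_some {i : ℕ} {p : Packet} (h : s.packet n i = some p) :
    (s.Asks i ∨ i ∈ s.askers) ∧ p.best = min s.best (n ^ 4) ∧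
      p.mass = (if s.Forwards i then min s.mass n else 0) ∧
      (p.ask = true ↔ s.Asks i) ∧ p.done = s.done := by
  unfold packet at h
  split_ifs at h with h1 h2 <;> cases h <;> simp [h1, h2]

theorem card_asks_le (s : NodeState) (d : ℕ) : #{i : Fin d | s.Asks i} ≤ 2 := by
  have key : ∀ o : Option ℕ, #{i : Fin d | o = some (i : ℕ)} ≤ 1 := fun o =>
    card_le_one.2 fun a ha b hb => by
      simp only [mem_filter, mem_univ, true_and] at ha hb
      exact Fin.ext (Option.some.inj (ha.symm.trans hb))
  calc #{i : Fin d | s.Asks i}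
      ≤ #(({i : Fin d | s.contact = some (i : ℕ)} : Finset (Fin d)) ∪
          ({i : Fin d | s.parent = some (i : ℕ)} : Finset (Fin d))) :=
        card_le_card fun i hi => by
          simp only [mem_filter, mem_univ, true_and, mem_union] at hi ⊢
          exact hi.2
    _ ≤ _ := card_union_le _ _
    _ ≤ 2 := by linarith [key s.contact, key s.parent]

end NodeState

/-- A binary code for messages. -/
structure Codec (L : ℕ) where
  /-- the encoding -/
  enc : Packet → (Fin L → Bool)
  /-- the decoding -/
  dec : (Fin L → Bool) → Packet

/-- The code is injective on the messages that occur in a network of `n` nodes. -/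
def Codec.Faithful {L : ℕ} (c : Codec L) (n : ℕ) : Prop :=
  ∀ p : Packet, p.best ≤ n ^ 4 → p.mass ≤ n → c.dec (c.enc p) = p

/-- Counting suffices: the relevant packets number at most `n ^ 9`, and there are at least `n ^ 10`
bit strings. -/
theorem exists_codec {n : ℕ} (hn : 2 ≤ n) : ∃ c : Codec (10 * Nat.clog 2 n), c.Faithful n := by
  have hcard : Fintype.card (Fin (n ^ 4 + 1) × Fin (n + 1) × Bool × Bool) ≤
      Fintype.card (Fin (10 * Nat.clog 2 n) → Bool) := by
    simp only [Fintype.card_prod, Fintype.card_fin, Fintype.card_bool, Fintype.card_fun]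
    have h1 : n ≤ 2 ^ Nat.clog 2 n := Nat.le_pow_clog one_lt_two n
    have h4 : n ^ 4 + 1 ≤ n ^ 5 := by
      have : 1 ≤ n ^ 4 := Nat.one_le_pow _ _ (by omega)
      calc n ^ 4 + 1 ≤ n ^ 4 * 2 := by omega
        _ ≤ n ^ 4 * n := Nat.mul_le_mul_left _ hn
        _ = n ^ 5 := by ring
    have h2 : n + 1 ≤ n ^ 2 := by nlinarith
    have h3 : 2 * 2 ≤ n ^ 2 := by nlinarith
    calc (n ^ 4 + 1) * ((n + 1) * (2 * 2)) ≤ n ^ 5 * (n ^ 2 * n ^ 2) :=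
          Nat.mul_le_mul h4 (Nat.mul_le_mul h2 h3)
      _ = n ^ 9 := by ring
      _ ≤ n ^ 10 := Nat.pow_le_pow_right (by omega) (by norm_num)
      _ ≤ (2 ^ Nat.clog 2 n) ^ 10 := Nat.pow_le_pow_left h1 10
      _ = 2 ^ (10 * Nat.clog 2 n) := by rw [← pow_mul, mul_comm]
  obtain ⟨f⟩ := Function.Embedding.nonempty_of_card_le hcard
  refine ⟨⟨fun p => f (Fin.ofNat _ p.best, Fin.ofNat _ p.mass, p.ask, p.done), fun x =>
    let y := Function.invFun f x
    ⟨y.1, y.2.1, y.2.2.1, y.2.2.2⟩⟩, fun p h1 h2 => ?_⟩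
  simp only [Function.leftInverse_invFun f.injective _]
  rcases p with ⟨a, b, c, d⟩
  simp only [Fin.val_ofNat, Packet.mk.injEq, and_self, and_true]
  exact ⟨Nat.mod_eq_of_lt (Nat.lt_succ_of_le h1), Nat.mod_eq_of_lt (Nat.lt_succ_of_le h2)⟩

/-- The law of a random port of a node of degree `d`. -/
def portLaw (d : ℕ) : PMF ℕ :=
  if h : d = 0 then PMF.pure 0
  else PMF.uniformOfFinset (Finset.range d) (Finset.nonempty_range_iff.2 h)

/-- Every node spreads the largest known id by push-pull gossip and counts the nodes that know it
along the tree of first receptions; the owner of the largest id declares the election to be over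
when it has counted all `n` nodes. -/
def gossip (n : ℕ) {L : ℕ} (c : Codec L) : Protocol L where
  State := NodeState
  coin := portLaw
  init _ ident := NodeState.initial ident
  send _ s i := (s.packet n i).map c.enc
  step _ s inb coin := s.advance n (fun i => (inb i).map c.dec) coin
  -- Once any node is done, all nodes know the largest id, and then only its owner has no parent.
  flag s := s.done && s.parent.isNone
  leaderId s := some s.best
  flag_init _ _ := rfl

/-! ### Executions without the binary encoding. -/

section Execution

set_option linter.unusedSectionVars false

open Finset NodeState Classical

variable {V : Type} [Fintype V] [DecidableEq V] {G : SimpleGraph V} [DecidableRel G.Adj]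
  (ports : PortNumbering G)

/-- The port of `u` that leads to `v`. -/
def portTo {u v : V} (h : G.Adj u v) : Fin (G.degree u) := (ports u).symm ⟨v, h⟩

/-- The message from `u` to `v`. -/
def wire (n : ℕ) (s : V → NodeState) (u v : V) : Option Packet :=
  if h : G.Adj u v then (s u).packet n (portTo ports h) else none

/-- `σ` is the sequence of configurations of an execution with given ids and coins. -/
structure IsExecution (n : ℕ) (ident : V → ℕ) (coin : V → ℕ → ℕ) (σ : ℕ → V → NodeState) :
    Prop where
  zero : ∀ v, σ 0 v = initial (ident v)
  succ : ∀ t v, σ (t + 1) v =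
    (σ t v).advance n (fun i => wire ports n (σ t) (ports v i).1 v) (coin v t)

theorem ports_portTo {u v : V} (h : G.Adj u v) : (ports u (portTo ports h)).1 = v := by
  simp [portTo]

theorem adj_ports (v : V) (i : Fin (G.degree v)) : G.Adj v (ports v i).1 := (ports v i).2

theorem portTo_ports (v : V) (i : Fin (G.degree v)) : portTo ports (adj_ports ports v i) = i :=
  (ports v).symm_apply_apply i

theorem portTo_inj {u v w : V} (hv : G.Adj u v) (hw : G.Adj u w)
    (h : (portTo ports hv : ℕ) = portTo ports hw) : v = w := by
  rw [← ports_portTo ports hv, ← ports_portTo ports hw, Fin.ext h]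

theorem sum_ports {M : Type*} [AddCommMonoid M] (v : V) (f : V → M)
    (hf : ∀ u, ¬ G.Adj v u → f u = 0) : ∑ i, f (ports v i).1 = ∑ u, f u := by
  rw [(ports v).sum_comp fun x : G.neighborSet v => f x.1]
  rw [← sum_subtype (G.neighborFinset v) (fun u => by simp) f]
  exact sum_subset (subset_univ _) fun u _ hu => hf u (by simpa using hu)

theorem wire_of_adj {n : ℕ} {s : V → NodeState} {u v : V} (h : G.Adj u v) :
    wire ports n s u v = (s u).packet n (portTo ports h) := dif_pos h

theorem wire_of_not_adj {n : ℕ} {s : V → NodeState} {u v : V} (h : ¬ G.Adj u v) :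
    wire ports n s u v = none := dif_neg h

/-- The configurations of the gossip protocol. -/
def gossipRun (n : ℕ) {L : ℕ} (c : Codec L) (ω : Protocol.Outcome V) : ℕ → V → NodeState :=
  (gossip n c).run ports ω

/-- Packets are truncated before encoding, so decoding recovers them for every outcome, even with
bad ids. -/
theorem gossipRun_isExecution {n L : ℕ} {c : Codec L} (hc : c.Faithful n)
    (ω : Protocol.Outcome V) : IsExecution ports n (fun v => (ω v).1) (fun v => (ω v).2)
      (gossipRun ports n c ω) where
  zero _ := rfl
  succ t v := by
    have key : (fun i => Option.map c.dec (Option.map c.enc ((gossipRun ports n c ω t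
        (ports v i).1).packet n (portTo ports (adj_ports ports v i).symm)))) =
        fun i => wire ports n (gossipRun ports n c ω t) (ports v i).1 v := by
      funext i
      rw [wire_of_adj ports (adj_ports ports v i).symm, Option.map_map]
      refine (Option.map_congr fun p hp => ?_).trans (Option.map_id' ..)
      obtain ⟨-, h1, h2, -⟩ := packet_eq_some hp
      refine hc p (h1 ▸ min_le_right _ _) ?_
      rw [h2]
      split_ifs
      exacts [min_le_right _ _, Nat.zero_le _]
    rw [← key]
    rfl

end Execution

/-! ### Deterministic correctness: counting, termination and message count. -/

section Election

set_option linter.unusedSectionVars false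

open Finset NodeState Classical

variable {V : Type} [Fintype V] [DecidableEq V] {G : SimpleGraph V} [DecidableRel G.Adj]
  {ports : PortNumbering G} {n : ℕ} {ident : V → ℕ} {coin : V → ℕ → ℕ} {σ : ℕ → V → NodeState}

theorem wire_eq_some {s : V → NodeState} {u v : V} {p : Packet}
    (h : wire ports n s u v = some p) :
    ∃ huv : G.Adj u v, ((s u).Asks (portTo ports huv) ∨ (portTo ports huv : ℕ) ∈ (s u).askers) ∧
      p.best = min (s u).best (n ^ 4) ∧
      p.mass = (if (s u).Forwards (portTo ports huv) then min (s u).mass n else 0) ∧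
      (p.ask = true ↔ (s u).Asks (portTo ports huv)) ∧ p.done = (s u).done := by
  by_cases huv : G.Adj u v
  · rw [wire_of_adj ports huv] at h
    exact ⟨huv, packet_eq_some h⟩
  · rw [wire_of_not_adj ports huv] at h
    cases h

theorem exists_wire_of_asks {s : V → NodeState} {u v : V} (huv : G.Adj u v)
    (h : (s u).Asks (portTo ports huv) ∨ (portTo ports huv : ℕ) ∈ (s u).askers) :
    ∃ p, wire ports n s u v = some p := by
  rw [wire_of_adj ports huv, packet, if_pos h]
  exact ⟨_, rfl⟩

namespace IsExecution


theorem best_mono (hσ : IsExecution ports n ident coin σ)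
    {s t : ℕ} (h : s ≤ t) (v : V) : (σ s v).best ≤ (σ t v).best := by
  induction t, h using Nat.le_induction with
  | base => rfl
  | succ t _ ih =>
    rw [hσ.succ]
    exact ih.trans best_le_advance

theorem done_mono (hσ : IsExecution ports n ident coin σ)
    {s t : ℕ} (h : s ≤ t) {v : V} (hv : (σ s v).done = true) :
    (σ t v).done = true := by
  induction t, h using Nat.le_induction with
  | base => exact hv
  | succ t _ ih =>
    rw [hσ.succ, done_advance]
    exact Or.inl ih

theorem not_done_of_le (hσ : IsExecution ports n ident coin σ)
    {s t : ℕ} (h : s ≤ t) {v : V} (hv : (σ t v).done = false) :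
    (σ s v).done = false := by
  by_contra hs
  simp [hσ.done_mono h (by simpa using hs)] at hv

theorem best_le_of_wire (hσ : IsExecution ports n ident coin σ) {t : ℕ} {u v : V} {p : Packet}
    (h : wire ports n (σ t) u v = some p) : p.best ≤ (σ (t + 1) v).best := by
  obtain ⟨huv, -⟩ := wire_eq_some h
  rw [hσ.succ]
  refine le_of_eq_of_le ?_ (heard_le_advance (portTo ports huv.symm))
  rw [heard, ports_portTo, h]
  rfl

theorem done_of_wire (hσ : IsExecution ports n ident coin σ) {t : ℕ} {u v : V} {p : Packet}
    (h : wire ports n (σ t) u v = some p) (hp : p.done = true) : (σ (t + 1) v).done = true := by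
  obtain ⟨huv, -⟩ := wire_eq_some h
  rw [hσ.succ, done_advance]
  exact Or.inr (Or.inl ⟨portTo ports huv.symm, p, by rw [ports_portTo, h], hp⟩)

theorem mem_askers_iff (hσ : IsExecution ports n ident coin σ) {t : ℕ} {u v : V} (h : G.Adj v u) :
    (portTo ports h : ℕ) ∈ (σ (t + 1) v).askers ↔ (σ t u).Asks (portTo ports h.symm) := by
  rw [hσ.succ, mem_askers_advance, ports_portTo]
  constructor
  · rintro ⟨p, hp, hask⟩
    obtain ⟨_, -, -, -, h', -⟩ := wire_eq_some hp
    exact h'.1 hask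
  · intro hask
    obtain ⟨p, hp⟩ := exists_wire_of_asks (n := n) h.symm (Or.inl hask)
    obtain ⟨_, -, -, -, h', -⟩ := wire_eq_some hp
    exact ⟨p, hp, h'.2 hask⟩

/-- What happens to the largest id, the count and the parent of a node in one round. -/
theorem step_cases (hσ : IsExecution ports n ident coin σ) (t : ℕ) (v : V) :
    (∃ (u : V) (h : G.Adj v u), (σ t v).best < (σ (t + 1) v).best ∧
      (σ (t + 1) v).best = min (σ t u).best (n ^ 4) ∧ (σ (t + 1) v).mass = 1 ∧
      (σ (t + 1) v).parent = some (portTo ports h : ℕ)) ∨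
    ((σ (t + 1) v).best = (σ t v).best ∧
      (σ (t + 1) v).mass = (σ t v).kept + ∑ u, (wire ports n (σ t) u v).elim 0
        (fun p => if p.best = (σ t v).best then p.mass else 0) ∧
      (σ (t + 1) v).parent = (σ t v).parent) := by
  rcases advance_cases n (σ t v) (fun i => wire ports n (σ t) (ports v i).1 v) (coin v t) with
    ⟨i, hi, h1, h2, h3⟩ | ⟨-, h1, h2, h3⟩ <;> rw [← hσ.succ] at h1 h2 h3
  · left
    refine ⟨(ports v i).1, adj_ports ports v i, h1 ▸ hi.1, ?_, h2, by rw [h3, portTo_ports]⟩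
    have h0 := hi.1
    rw [h1]
    unfold heard at h0 ⊢
    rcases hw : wire ports n (σ t) (ports v i).1 v with _ | p
    · simp [hw] at h0
    · obtain ⟨_, -, h, -⟩ := wire_eq_some hw
      simp only [hw, Option.elim_some]
      exact h
  · refine Or.inr ⟨h1, ?_, h3⟩
    rw [h2, received, sum_ports ports v (fun u => (wire ports n (σ t) u v).elim 0
      (fun p => if p.best = (σ t v).best then p.mass else 0))]
    intro u hu
    rw [wire_of_not_adj ports fun h => hu h.symm]
    rfl

/-- Every adoption of an id sets a parent, and no step removes one. -/
theorem best_eq_of_parent_eq_none (hσ : IsExecution ports n ident coin σ)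
    (t : ℕ) {v : V} (h : (σ t v).parent = none) :
    (σ t v).best = ident v := by
  induction t with
  | zero => rw [hσ.zero]; rfl
  | succ t ih =>
    rcases hσ.step_cases t v with ⟨u, _, -, -, -, h3⟩ | ⟨h1, -, h3⟩
    · simp [h] at h3
    · rw [h1, ih (h3 ▸ h)]

end IsExecution

/-- An execution with distinct ids of bounded size, the largest of which belongs to `l`. -/
structure IsElection (ports : PortNumbering G) (n : ℕ) (ident : V → ℕ) (coin : V → ℕ → ℕ)
    (σ : ℕ → V → NodeState) (l : V) : Prop extends IsExecution ports n ident coin σ where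
  card_eq : Fintype.card V = n
  inj : Function.Injective ident
  ident_le : ∀ v, ident v ≤ n ^ 4
  le_lead : ∀ v, ident v ≤ ident l

/-- The set of nodes whose largest known id is `x`. -/
def informed (s : V → NodeState) (x : ℕ) : Finset V := {v | (s v).best = x}

theorem mem_informed {s : V → NodeState} {x : ℕ} {v : V} :
    v ∈ informed s x ↔ (s v).best = x := by simp [informed]

/-- `u` is the parent of `v`. -/
def IsParent (ports : PortNumbering G) (s : V → NodeState) (v u : V) : Prop :=
  ∃ h : G.Adj v u, (s v).parent = some (portTo ports h : ℕ)

/-- The count that `u` hands over to `v`. -/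
def flow (ports : PortNumbering G) (n : ℕ) (s : V → NodeState) (u v : V) : ℕ :=
  (wire ports n s u v).elim 0 Packet.mass

theorem isParent_of_flow_ne_zero {s : V → NodeState} {u v : V} (h : flow ports n s u v ≠ 0) :
    (s u).done = false ∧ IsParent ports s u v ∧ flow ports n s u v = min (s u).mass n := by
  unfold flow at h ⊢
  rcases hw : wire ports n s u v with _ | p
  · simp [hw] at h
  · obtain ⟨huv, -, -, hm, -⟩ := wire_eq_some hw
    simp only [hw, Option.elim_some] at h ⊢
    split_ifs at hm with hf
    · exact ⟨hf.1, ⟨huv, hf.2⟩, hm⟩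
    · exact absurd hm h

theorem flow_of_isParent {s : V → NodeState} {u v : V} (hd : (s u).done = false)
    (h : IsParent ports s u v) : flow ports n s u v = min (s u).mass n := by
  obtain ⟨huv, hp⟩ := h
  obtain ⟨p, hw⟩ := exists_wire_of_asks (n := n) (s := s) huv (Or.inl ⟨hd, Or.inr hp⟩)
  obtain ⟨_, -, -, hm, -⟩ := wire_eq_some hw
  rw [if_pos ⟨hd, hp⟩] at hm
  rw [flow, hw]
  exact hm

theorem IsParent.unique {s : V → NodeState} {u v w : V} (hv : IsParent ports s u v)
    (hw : IsParent ports s u w) : v = w := by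
  obtain ⟨h1, h1'⟩ := hv
  obtain ⟨h2, h2'⟩ := hw
  exact portTo_inj ports h1 h2 (Option.some.inj (h1'.symm.trans h2'))

/-- A count is either kept or handed to the single parent, never both. -/
theorem kept_add_sum_flow_le (s : V → NodeState) (u : V) :
    (s u).kept + ∑ v, flow ports n s u v ≤ (s u).mass := by
  by_cases h : ∃ v, flow ports n s u v ≠ 0
  · obtain ⟨v, hv⟩ := h
    obtain ⟨hd, hp, hf⟩ := isParent_of_flow_ne_zero hv
    have h0 : (s u).kept = 0 := by
      obtain ⟨_, hp'⟩ := hp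
      simp [kept, hd, hp']
    rw [sum_eq_single v (fun w _ hw => ?_) (by simp), hf, h0, zero_add]
    · exact min_le_left _ _
    · by_contra hne
      exact hw ((isParent_of_flow_ne_zero hne).2.1.unique hp)
  · push Not at h
    simp only [h, sum_const_zero, add_zero, kept]
    split_ifs
    · rfl
    · exact Nat.zero_le _

/-- The nodes counted on behalf of the id `y`, together with those that may still be counted. -/
def tally (s : V → NodeState) (y : ℕ) : ℕ :=
  ∑ v, if (s v).best = y then (s v).mass else if (s v).best < y then 1 else 0

namespace IsElection

variable {l : V}

theorem best_le (hσ : IsElection ports n ident coin σ l)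
    (t : ℕ) (v : V) : (σ t v).best ≤ ident l := by
  induction t generalizing v with
  | zero => rw [hσ.zero]; exact hσ.le_lead v
  | succ t ih =>
    rcases hσ.step_cases t v with ⟨u, _, -, h, -⟩ | ⟨h, -⟩ <;> rw [h]
    exacts [(min_le_left _ _).trans (ih u), ih v]

theorem min_best (hσ : IsElection ports n ident coin σ l)
    (t : ℕ) (v : V) : min (σ t v).best (n ^ 4) = (σ t v).best :=
  min_eq_left ((hσ.best_le t v).trans (hσ.ident_le l))

theorem best_lead (hσ : IsElection ports n ident coin σ l) (t : ℕ) : (σ t l).best = ident l := by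
  refine (hσ.best_le t l).antisymm ?_
  have := hσ.best_mono (Nat.zero_le t) l
  rwa [hσ.zero] at this

theorem parent_lead (hσ : IsElection ports n ident coin σ l) (t : ℕ) : (σ t l).parent = none := by
  induction t with
  | zero => rw [hσ.zero]; rfl
  | succ t ih =>
    rcases hσ.step_cases t l with ⟨u, _, h, -⟩ | ⟨-, -, h⟩
    · rw [hσ.best_lead, hσ.best_lead] at h
      exact absurd h (lt_irrefl _)
    · rw [h, ih]

theorem eq_lead_of_parent_eq_none (hσ : IsElection ports n ident coin σ l)
    {t : ℕ} {v : V} (h : (σ t v).best = ident l)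
    (hp : (σ t v).parent = none) : v = l :=
  hσ.inj ((hσ.best_eq_of_parent_eq_none t hp).symm.trans h)

theorem best_persist (hσ : IsElection ports n ident coin σ l)
    {s t : ℕ} (hst : s ≤ t) {v : V} (h : (σ s v).best = ident l) :
    (σ t v).best = ident l :=
  (hσ.best_le t v).antisymm (h ▸ hσ.best_mono hst v)

theorem parent_persist (hσ : IsElection ports n ident coin σ l)
    {s t : ℕ} (hst : s ≤ t) {v : V} (h : (σ s v).best = ident l) :
    (σ t v).parent = (σ s v).parent := by
  induction t, hst using Nat.le_induction with
  | base => rfl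
  | succ t hst ih =>
    rcases hσ.step_cases t v with ⟨u, _, hstep, -⟩ | ⟨-, -, hstep⟩
    · rw [hσ.best_persist hst h, hσ.best_persist (Nat.le_succ_of_le hst) h] at hstep
      exact absurd hstep (lt_irrefl _)
    · rw [hstep, ih]

/-- The informed nodes form a tree rooted at the leader, of depth at most the elapsed time. -/
theorem exists_rank (hσ : IsElection ports n ident coin σ l)
    (t : ℕ) : ∃ rank : V → ℕ, (∀ v, rank v ≤ t) ∧
    ∀ v, v ≠ l → (σ t v).best = ident l →
      ∃ u, IsParent ports (σ t) v u ∧ (σ t u).best = ident l ∧ rank u < rank v := by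
  induction t with
  | zero =>
    refine ⟨fun _ => 0, fun _ => le_rfl, fun v hv h => absurd ?_ hv⟩
    rw [hσ.zero] at h
    exact hσ.inj h
  | succ t ih =>
    obtain ⟨rank, hrank, hpar⟩ := ih
    -- The rank is the round in which a node became informed, with the current time as a provisional
    -- value for the others.
    refine ⟨fun v => if (σ t v).best = ident l then rank v else t + 1, fun v => ?_,
      fun v hv h => ?_⟩
    · dsimp only
      split_ifs
      exacts [(hrank v).trans (Nat.le_succ t), le_rfl]
    · rcases hσ.step_cases t v with ⟨u, hvu, h1, h2, -, h4⟩ | ⟨h1, -, h3⟩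
      · have hu : (σ t u).best = ident l := by rw [← hσ.min_best t u, ← h2, h]
        refine ⟨u, ⟨hvu, h4⟩, hσ.best_persist (Nat.le_succ t) hu, ?_⟩
        dsimp only
        rw [if_pos hu, if_neg (by omega)]
        exact Nat.lt_succ_of_le (hrank u)
      · rw [h1] at h
        obtain ⟨u, ⟨hvu, hp⟩, hu, hlt⟩ := hpar v hv h
        exact ⟨u, ⟨hvu, h3.trans hp⟩, hσ.best_persist (Nat.le_succ t) hu, by
          dsimp only
          rwa [if_pos hu, if_pos h]⟩

theorem exists_parent (hσ : IsElection ports n ident coin σ l)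
    {t : ℕ} {v : V} (hv : v ≠ l) (h : (σ t v).best = ident l) :
    ∃ u, IsParent ports (σ t) v u ∧ (σ t u).best = ident l := by
  obtain ⟨_, -, hpar⟩ := hσ.exists_rank t
  obtain ⟨u, h1, h2, -⟩ := hpar v hv h
  exact ⟨u, h1, h2⟩

theorem wire_elim_eq (hσ : IsElection ports n ident coin σ l) (t : ℕ) (y : ℕ) (u v : V) :
    (wire ports n (σ t) u v).elim 0 (fun p => if p.best = y then p.mass else 0) =
      if (σ t u).best = y then flow ports n (σ t) u v else 0 := by
  rw [flow]
  rcases hw : wire ports n (σ t) u v with _ | p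
  · simp
  · obtain ⟨_, -, hb, -⟩ := wire_eq_some hw
    simp [hb, hσ.min_best]

/-- A version of the tally after a round in terms of the flow during the round. -/
theorem sum_kept_add_flow (t : ℕ) (y : ℕ) :
    (∑ v, if (σ t v).best = y then (σ t v).kept +
      ∑ u, (if (σ t u).best = y then flow ports n (σ t) u v else 0)
        else if (σ t v).best < y then 1 else 0) =
    ∑ u, if (σ t u).best = y then (σ t u).kept +
      ∑ v, (if (σ t v).best = y then flow ports n (σ t) u v else 0)
        else if (σ t u).best < y then 1 else 0 := by
  have key : ∀ f : V → V → ℕ, (∑ v, if (σ t v).best = y then (σ t v).kept +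
      ∑ u, (if (σ t u).best = y then f u v else 0) else if (σ t v).best < y then 1 else 0) =
      (∑ v, if (σ t v).best = y then (σ t v).kept else if (σ t v).best < y then 1 else 0) +
      ∑ v, ∑ u, if (σ t v).best = y ∧ (σ t u).best = y then f u v else 0 := fun f => by
    rw [← sum_add_distrib]
    refine sum_congr rfl fun v _ => ?_
    by_cases h : (σ t v).best = y <;> simp [h]
  rw [key, key fun v u => flow ports n (σ t) u v]
  congr 1
  rw [sum_comm]
  simp only [and_comm]

/-- A node that adopts `y` trades its potential 1 for the count 1. Counts that reach a node with
another id, or sit at a node that adopts a larger id, are lost; none is created. -/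
theorem tally_succ_le (hσ : IsElection ports n ident coin σ l)
    (t : ℕ) (y : ℕ) : tally (σ (t + 1)) y ≤ tally (σ t) y := by
  calc tally (σ (t + 1)) y ≤ ∑ v, if (σ t v).best = y then (σ t v).kept +
      ∑ u, (if (σ t u).best = y then flow ports n (σ t) u v else 0)
        else if (σ t v).best < y then 1 else 0 := by
        refine sum_le_sum fun v _ => ?_
        rcases hσ.step_cases t v with ⟨u, _, h1, -, h2, -⟩ | ⟨h1, h2, -⟩
        · rw [h2]
          split_ifs <;> omega
        · rw [h1, h2]
          split_ifs with h
          · simp only [hσ.wire_elim_eq, h]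
            rfl
          · rfl
          · rfl
    _ = _ := sum_kept_add_flow t y
    _ ≤ tally (σ t) y := by
      refine sum_le_sum fun u _ => ?_
      split_ifs
      · refine le_trans (Nat.add_le_add_left (sum_le_sum fun v _ => ?_) _)
          (kept_add_sum_flow_le (ports := ports) (n := n) (σ t) u)
        split_ifs
        exacts [le_rfl, Nat.zero_le _]
      · rfl
      · rfl

theorem tally_le (hσ : IsElection ports n ident coin σ l)
    (t : ℕ) (y : ℕ) : tally (σ t) y ≤ #{v | ident v ≤ y} := by
  induction t with
  | zero =>
    rw [card_filter]
    refine sum_le_sum fun v _ => ?_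
    simp only [hσ.zero, initial]
    split_ifs <;> omega
  | succ t ih => exact (hσ.tally_succ_le t y).trans ih

theorem mass_le_tally (s : V → NodeState) (v : V) : (s v).mass ≤ tally s (s v).best := by
  refine le_trans ?_ (single_le_sum (f := fun w => if (s w).best = (s v).best then (s w).mass
    else if (s w).best < (s v).best then 1 else 0) (fun _ _ => Nat.zero_le _) (mem_univ v))
  simp

theorem mass_le (hσ : IsElection ports n ident coin σ l) (t : ℕ) (v : V) : (σ t v).mass ≤ n :=
  (mass_le_tally (σ t) v).trans ((hσ.tally_le t _).trans
    ((card_le_univ _).trans_eq hσ.card_eq))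

/-- For the largest id nothing is lost: no node abandons it, and the parent of an informed node is
informed, so each count handed over is received. -/
theorem tally_lead (hσ : IsElection ports n ident coin σ l)
    (t : ℕ) : tally (σ t) (ident l) = n := by
  refine le_antisymm ((hσ.tally_le t _).trans ((card_le_univ _).trans_eq hσ.card_eq)) ?_
  induction t with
  | zero =>
    rw [← hσ.card_eq, ← card_univ, card_eq_sum_ones]
    refine sum_le_sum fun v _ => ?_
    simp only [hσ.zero, initial]
    have := hσ.le_lead v
    split_ifs <;> omega
  | succ t ih =>
    refine ih.trans ?_
    calc tally (σ t) (ident l) ≤ ∑ u, if (σ t u).best = ident l then (σ t u).kept +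
            ∑ v, (if (σ t v).best = ident l then flow ports n (σ t) u v else 0)
              else if (σ t u).best < ident l then 1 else 0 := by
          refine sum_le_sum fun u _ => ?_
          split_ifs with h
          · by_cases hk : (σ t u).done = true ∨ (σ t u).parent = none
            · rw [kept, if_pos hk]
              exact Nat.le_add_right _ _
            · push Not at hk
              obtain ⟨w, hw, hw'⟩ := hσ.exists_parent (t := t) (v := u)
                (fun hul => hk.2 (hul ▸ hσ.parent_lead t)) h
              refine le_trans ?_ (Nat.le_add_left _ _)
              refine le_trans ?_ (single_le_sum (f := fun v => if (σ t v).best = ident l then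
                flow ports n (σ t) u v else 0) (fun _ _ => Nat.zero_le _) (mem_univ w))
              simp only [if_pos hw']
              rw [flow_of_isParent (by simpa using hk.1) hw, min_eq_left (hσ.mass_le t u)]
          · rfl
          · exact Nat.zero_le _
      _ = _ := (sum_kept_add_flow t (ident l)).symm
      _ ≤ tally (σ (t + 1)) (ident l) := by
        refine sum_le_sum fun v _ => ?_
        have hle := hσ.best_le (t + 1) v
        rcases hσ.step_cases t v with ⟨u, _, h1, -, h2, -⟩ | ⟨h1, h2, -⟩
        · rw [h2]
          split_ifs <;> omega
        · rw [h1, h2]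
          split_ifs with h
          · simp only [hσ.wire_elim_eq, h]
            rfl
          · rfl
          · rfl

/-- A node without parent counts for its own id, and by `tally_le` a count of `n` requires that no
id exceed it. -/
theorem eq_lead_of_mass_eq (hσ : IsElection ports n ident coin σ l)
    {t : ℕ} {v : V} (hp : (σ t v).parent = none)
    (hm : (σ t v).mass = n) : v = l := by
  by_contra hv
  have h1 := mass_le_tally (σ t) v
  rw [hσ.best_eq_of_parent_eq_none t hp, hm] at h1
  have h2 : (univ.filter fun w => ident w ≤ ident v) = univ :=
    (card_eq_iff_eq_univ _).1 (le_antisymm (card_le_univ _)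
      (hσ.card_eq.le.trans (h1.trans (hσ.tally_le t _))))
  have h3 : ident l ≤ ident v := by simpa using h2.ge (mem_univ l)
  exact hv (hσ.inj ((hσ.le_lead v).antisymm h3))

/-- The tally of the largest id is exactly `n`, and an uninformed node would add 1 to the `n` held
at the leader. -/
theorem all_informed_of_mass_eq (hσ : IsElection ports n ident coin σ l)
    {t : ℕ} (hm : (σ t l).mass = n) (v : V) :
    (σ t v).best = ident l := by
  by_contra hv
  have h1 := hσ.tally_lead t
  have hvl : v ≠ l := fun h => hv (h ▸ hσ.best_lead t)
  have hlt := lt_of_le_of_ne (hσ.best_le t v) hv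
  have h2 := add_le_sum (f := fun w => if (σ t w).best = ident l then (σ t w).mass
    else if (σ t w).best < ident l then 1 else 0) (s := univ) (fun _ _ => Nat.zero_le _)
    (mem_univ l) (mem_univ v) hvl.symm
  simp only [hσ.best_lead, if_true, if_neg hv, if_pos hlt, hm] at h2
  rw [tally] at h1
  omega

/-- A node that is done is preceded by the leader, and all nodes are informed. -/
theorem of_done (hσ : IsElection ports n ident coin σ l) {t : ℕ} {v : V} (h : (σ t v).done = true) :
    (σ t l).done = true ∧ ∀ w, (σ t w).best = ident l := by
  induction t generalizing v with
  | zero => rw [hσ.zero] at h; simp [initial] at h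
  | succ t ih =>
    have key : ∀ u, (σ t u).done = true →
        (σ (t + 1) l).done = true ∧ ∀ w, (σ (t + 1) w).best = ident l := fun u hu =>
      ⟨hσ.done_mono (Nat.le_succ t) (ih hu).1, fun w =>
        hσ.best_persist (Nat.le_succ t) ((ih hu).2 w)⟩
    have h' := h
    rw [hσ.succ, done_advance, ← hσ.succ] at h'
    rcases h' with h' | ⟨i, p, hw, hp⟩ | ⟨hp, hm⟩
    · exact key v h'
    · obtain ⟨_, -, -, -, -, hd⟩ := wire_eq_some hw
      exact key _ (hd ▸ hp)
    · obtain rfl := hσ.eq_lead_of_mass_eq hp hm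
      exact ⟨h, hσ.all_informed_of_mass_eq hm⟩

theorem not_done (hσ : IsElection ports n ident coin σ l)
    {t : ℕ} (h : (σ t l).done = false) (v : V) : (σ t v).done = false := by
  by_contra hv
  simp [(hσ.of_done (by simpa using hv)).1] at h

theorem done_lead_of_mass_eq (hσ : IsElection ports n ident coin σ l)
    {t : ℕ} (hm : (σ (t + 1) l).mass = n) :
    (σ (t + 1) l).done = true := by
  have hp := hσ.parent_lead (t + 1)
  rw [hσ.succ] at hm hp ⊢
  rw [done_advance]
  exact Or.inr (Or.inr ⟨hp, hm⟩)

section AllInformed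

variable {t₀ : ℕ}

theorem isParent_iff (hσ : IsElection ports n ident coin σ l)
    (hall : ∀ v, (σ t₀ v).best = ident l) {t : ℕ} (ht : t₀ ≤ t) (u v : V) :
    IsParent ports (σ t) u v ↔ IsParent ports (σ t₀) u v := by
  rw [IsParent, IsParent, hσ.parent_persist ht (hall u)]

/-- Once all nodes are informed, the counts move towards the leader. -/
theorem rank_add_le (hσ : IsElection ports n ident coin σ l)
    (hall : ∀ v, (σ t₀ v).best = ident l) {rank : V → ℕ} (hrank : ∀ v, rank v ≤ t₀)
    (hpar : ∀ u v, IsParent ports (σ t₀) u v → rank v < rank u) (j : ℕ)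
    (hl : (σ (t₀ + j) l).done = false) {v : V} (hv : v ≠ l) (hm : (σ (t₀ + j) v).mass ≠ 0) :
    rank v + j ≤ t₀ := by
  induction j generalizing v with
  | zero => exact hrank v
  | succ j ih =>
    have hl' := hσ.not_done_of_le (Nat.le_succ (t₀ + j)) hl
    have hbest : ∀ w, (σ (t₀ + j) w).best = ident l := fun w =>
      hσ.best_persist (Nat.le_add_right _ _) (hall w)
    obtain ⟨w, ⟨_, hw⟩, -⟩ := hσ.exists_parent hv (hbest v)
    rcases hσ.step_cases (t₀ + j) v with ⟨u, _, h1, -⟩ | ⟨-, h2, -⟩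
    · rw [hbest] at h1
      exact absurd (hσ.best_le _ v) (not_le.2 h1)
    -- Nothing is kept at `v`, so a nonzero count came from a child, whose rank is larger.
    · rw [← add_assoc, h2, kept, if_neg (by simp [hσ.not_done hl' v, hw]), zero_add] at hm
      obtain ⟨u, -, hu⟩ := exists_ne_zero_of_sum_ne_zero hm
      rw [hσ.wire_elim_eq, if_pos ((hbest u).trans (hbest v).symm)] at hu
      obtain ⟨-, hp, hf⟩ := isParent_of_flow_ne_zero hu
      have hul : u ≠ l := by
        rintro rfl
        obtain ⟨_, hp⟩ := hp
        simp [hσ.parent_lead] at hp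
      have := ih hl' hul (fun h0 => hu (by rw [hf, h0, Nat.zero_min]))
      have := hpar u v ((hσ.isParent_iff hall (Nat.le_add_right _ _) u v).1 hp)
      omega

/-- Ranks are at most `t₀`, so after `t₀ + 1` further rounds no count is left outside the leader,
which therefore holds the whole tally `n`. -/
theorem done_lead (hσ : IsElection ports n ident coin σ l)
    (hall : ∀ v, (σ t₀ v).best = ident l) : (σ (2 * t₀ + 1) l).done = true := by
  by_contra hl
  have hl : (σ (t₀ + (t₀ + 1)) l).done = false := by
    rw [show t₀ + (t₀ + 1) = 2 * t₀ + 1 by ring]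
    simpa using hl
  obtain ⟨rank, hrank, hpar⟩ := hσ.exists_rank t₀
  have hpar' : ∀ u v, IsParent ports (σ t₀) u v → rank v < rank u := fun u v huv => by
    have hul : u ≠ l := by
      rintro rfl
      obtain ⟨_, hp⟩ := huv
      simp [hσ.parent_lead] at hp
    obtain ⟨w, hw, -, hlt⟩ := hpar u hul (hall u)
    rwa [huv.unique hw]
  have hbest : ∀ w, (σ (t₀ + (t₀ + 1)) w).best = ident l := fun w =>
    hσ.best_persist (Nat.le_add_right _ _) (hall w)
  have hzero : ∀ v, v ≠ l → (σ (t₀ + (t₀ + 1)) v).mass = 0 := fun v hv => by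
    by_contra hm
    have := hσ.rank_add_le hall hrank hpar' (t₀ + 1) hl hv hm
    omega
  have ht := hσ.tally_lead (t₀ + (t₀ + 1))
  rw [tally, sum_eq_single l (fun v _ hv => by rw [if_pos (hbest v), hzero v hv]) (by simp),
    if_pos (hbest l)] at ht
  exact Bool.false_ne_true (hl.symm.trans (hσ.done_lead_of_mass_eq (t := t₀ + t₀) ht))

/-- A node that is not done asks its parent in each round; question and answer take two rounds. -/
theorem done_of_isParent (hσ : IsElection ports n ident coin σ l)
    (hall : ∀ v, (σ t₀ v).best = ident l) {t : ℕ} (ht : t₀ ≤ t) {u v : V}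
    (h : IsParent ports (σ t₀) v u)
    (hu : (σ t u).done = true) : (σ (t + 2) v).done = true := by
  by_contra hv
  have hv0 : (σ t v).done = false := hσ.not_done_of_le (show t ≤ t + 2 by omega) (by simpa using hv)
  obtain ⟨hvu, hp⟩ := (hσ.isParent_iff hall ht v u).2 h
  have hask : (portTo ports hvu.symm : ℕ) ∈ (σ (t + 1) u).askers :=
    (hσ.mem_askers_iff hvu.symm).2 ⟨hv0, Or.inr hp⟩
  obtain ⟨p, hw⟩ := exists_wire_of_asks (n := n) hvu.symm (Or.inr hask)
  obtain ⟨_, -, -, -, -, hd⟩ := wire_eq_some hw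
  exact hv (hσ.done_of_wire hw (hd.trans (hσ.done_mono (Nat.le_succ t) hu)))

/-- The leader is done at `2 t₀ + 1`, and the news descends one level of the tree, of depth at most
`t₀`, in two rounds. -/
theorem all_done (hσ : IsElection ports n ident coin σ l)
    (hall : ∀ v, (σ t₀ v).best = ident l) {t : ℕ} (ht : 4 * t₀ + 1 ≤ t) (v : V) :
    (σ t v).done = true := by
  obtain ⟨rank, hrank, hpar⟩ := hσ.exists_rank t₀
  have key : ∀ j v, rank v ≤ j → (σ (2 * t₀ + 1 + 2 * j) v).done = true := fun j => by
    induction j with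
    | zero =>
      intro v hv
      rcases eq_or_ne v l with rfl | hvl
      · exact hσ.done_lead hall
      · obtain ⟨u, -, -, hlt⟩ := hpar v hvl (hall v)
        omega
    | succ j ih =>
      intro v hv
      rcases eq_or_ne v l with rfl | hvl
      · exact hσ.done_mono (by omega) (hσ.done_lead hall)
      · obtain ⟨u, hu, -, hlt⟩ := hpar v hvl (hall v)
        exact hσ.done_of_isParent hall (t := 2 * t₀ + 1 + 2 * j) (by omega) hu (ih u (by omega))
  exact hσ.done_mono (by omega) (key t₀ v (hrank v))

/-- One round beyond `all_done` is needed, because the last questions may still have to be answered.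
-/
theorem packet_eq_none (hσ : IsElection ports n ident coin σ l)
    (hall : ∀ v, (σ t₀ v).best = ident l) {t : ℕ} (ht : 4 * t₀ + 2 ≤ t) (v : V)
    (i : Fin (G.degree v)) :
    (σ t v).packet n i = none := by
  obtain ⟨t, rfl⟩ : ∃ s, t = s + 1 := ⟨t - 1, by omega⟩
  have hd := hσ.all_done hall (t := t) (by omega)
  rw [packet, if_neg]
  rintro (h | h)
  · have := h.1
    simp [hσ.done_mono (Nat.le_succ t) (hd v)] at this
  · rw [← portTo_ports ports v i, hσ.mem_askers_iff] at h
    have := h.1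
    simp [hd] at this

end AllInformed

/-- Three rounds spread the largest id along the random contacts in both directions. -/
theorem informed_of_contact (hσ : IsElection ports n ident coin σ l)
    {t : ℕ} {v w : V} (hvw : G.Adj v w)
    (hc : coin v t = portTo ports hvw) (h : (σ t v).best = ident l ∨ (σ t w).best = ident l) :
    (σ (t + 3) v).best = ident l ∧ (σ (t + 3) w).best = ident l := by
  -- If the leader is done, all nodes are informed already. Otherwise no node is done, and `v` does
  -- contact `w`: the coin of round `t` is drawn, then the question travels, then the answer, which
  -- gives three rounds.
  by_cases hl : (σ (t + 1) l).done = true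
  · have := (hσ.of_done hl).2
    exact ⟨hσ.best_persist (by omega) (this v), hσ.best_persist (by omega) (this w)⟩
  have hv : (σ (t + 1) v).done = false := hσ.not_done (by simpa using hl) v
  have hask : (σ (t + 1) v).Asks (portTo ports hvw) := by
    refine ⟨hv, Or.inl ?_⟩
    rw [hσ.succ, ← hc]
    rfl
  obtain ⟨p, hp⟩ := exists_wire_of_asks (n := n) hvw (Or.inl hask)
  obtain ⟨_, -, hpb, -⟩ := wire_eq_some hp
  have h1 := hσ.best_le_of_wire hp
  rw [hpb, hσ.min_best] at h1
  obtain ⟨q, hq⟩ := exists_wire_of_asks (n := n) (s := σ (t + 2)) hvw.symm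
    (Or.inr ((hσ.mem_askers_iff hvw.symm).2 hask))
  obtain ⟨_, -, hqb, -⟩ := wire_eq_some hq
  have h2 := hσ.best_le_of_wire hq
  rw [hqb, hσ.min_best] at h2
  have a1 := hσ.best_mono (show t ≤ t + 1 by omega) v
  have a2 := hσ.best_mono (show t ≤ t + 1 + 1 by omega) w
  have a3 := hσ.best_mono (show t + 1 + 1 ≤ t + 3 by omega) w
  have b1 := hσ.best_le (t + 3) v
  have b2 := hσ.best_le (t + 3) w
  change (σ (t + 2) w).best ≤ (σ (t + 3) v).best at h2
  change (σ (t + 1) v).best ≤ (σ (t + 2) w).best at h1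
  change (σ t w).best ≤ (σ (t + 2) w).best at a2
  change (σ (t + 2) w).best ≤ (σ (t + 3) w).best at a3
  rcases h with h | h <;> constructor <;> omega

end IsElection

/-- The total number of messages in a round is at most four times the number of nodes. -/
theorem IsExecution.sum_card_packet_le (hσ : IsExecution ports n ident coin σ) (t : ℕ) :
    ∑ v, #{i : Fin (G.degree v) | ((σ t v).packet n i).isSome} ≤ 4 * Fintype.card V := by
  have h1 : ∀ v, #{i : Fin (G.degree v) | ((σ t v).packet n i).isSome} ≤
      2 + #{i : Fin (G.degree v) | (i : ℕ) ∈ (σ t v).askers} := fun v => by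
    refine le_trans ?_ (Nat.add_le_add_right (card_asks_le (σ t v) (G.degree v)) _)
    refine le_trans (card_le_card fun i hi => ?_) (card_union_le _ _)
    obtain ⟨p, hp⟩ := Option.isSome_iff_exists.1 (mem_filter.1 hi).2
    simpa using (packet_eq_some hp).1
  -- A node of high degree may have to answer many questions, so answers are charged to the nodes
  -- that asked one round earlier.
  have h2 : ∑ v, #{i : Fin (G.degree v) | (i : ℕ) ∈ (σ t v).askers} ≤ 2 * Fintype.card V := by
    cases t with
    | zero => simp [hσ.zero, initial]
    | succ t =>
      let f : V → V → ℕ := fun u v => if ∃ h : G.Adj u v, (σ t u).Asks (portTo ports h) then 1 else 0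
      have hf : ∀ u v, ¬ G.Adj u v → f u v = 0 := fun u v h => if_neg fun ⟨h', _⟩ => h h'
      calc ∑ v, #{i : Fin (G.degree v) | (i : ℕ) ∈ (σ (t + 1) v).askers}
          = ∑ v, ∑ u, f u v := by
            refine sum_congr rfl fun v _ => ?_
            rw [← sum_ports ports v (fun u => f u v) fun u h => hf u v fun h' => h h'.symm,
              card_filter]
            refine sum_congr rfl fun i _ => if_congr ?_ rfl rfl
            conv_lhs => rw [← portTo_ports ports v i]
            rw [hσ.mem_askers_iff]
            exact ⟨fun h => ⟨_, h⟩, fun ⟨_, h⟩ => h⟩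
        _ = ∑ u, ∑ v, f u v := sum_comm
        _ = ∑ u, #{i : Fin (G.degree u) | (σ t u).Asks i} := by
            refine sum_congr rfl fun u _ => ?_
            rw [← sum_ports ports u (fun v => f u v) (hf u), card_filter]
            refine sum_congr rfl fun i _ => if_congr ?_ rfl rfl
            conv_rhs => rw [← portTo_ports ports u i]
            exact ⟨fun ⟨_, h⟩ => h, fun h => ⟨_, h⟩⟩
        _ ≤ ∑ _u : V, 2 := sum_le_sum fun u _ => card_asks_le _ _
        _ = 2 * Fintype.card V := by simp [mul_comm]
  calc _ ≤ ∑ v, (2 + #{i : Fin (G.degree v) | (i : ℕ) ∈ (σ t v).askers}) :=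
        sum_le_sum fun v _ => h1 v
    _ ≤ 4 * Fintype.card V := by
      rw [sum_add_distrib, sum_const, card_univ, smul_eq_mul]
      omega

end Election

/-! ### Expected progress of one push-pull step. -/

section Spread

set_option linter.unusedSectionVars false

open Finset MeasureTheory ProbabilityTheory

/-- A lower bound for the truncated mean of a weighted sum of pairwise independent indicators. -/
theorem half_le_integral_sub_sq {Ω ι : Type*} [MeasurableSpace Ω] {ν : Measure Ω}
    [IsProbabilityMeasure ν] (I : Finset ι) {X : ι → Ω → ℝ} {w p : ι → ℝ}
    (hX : ∀ i, Integrable (X i) ν) (hXX : ∀ i j, Integrable (fun y => X i y * X j y) ν)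
    (hidem : ∀ i y, X i y * X i y = X i y) (hp : ∀ i ∈ I, ∫ y, X i y ∂ν = p i)
    (hpp : ∀ i ∈ I, ∀ j ∈ I, i ≠ j → ∫ y, X i y * X j y ∂ν = p i * p j)
    (hp0 : ∀ i ∈ I, 0 ≤ p i) (hw0 : ∀ i ∈ I, 0 ≤ w i) (hw1 : ∀ i ∈ I, w i ≤ 1)
    (hμ : ∑ i ∈ I, w i * p i ≤ 1) :
    (∑ i ∈ I, w i * p i) / 2 ≤
      ∫ y, (∑ i ∈ I, w i * X i y - (∑ i ∈ I, w i * X i y) ^ 2 / 4) ∂ν := by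
  classical
  set μ := ∑ i ∈ I, w i * p i with hμdef
  have hμ0 : 0 ≤ μ := sum_nonneg fun i hi => mul_nonneg (hw0 i hi) (hp0 i hi)
  have hsq : ∀ y, (∑ i ∈ I, w i * X i y) ^ 2 =
      ∑ i ∈ I, ∑ j ∈ I, w i * w j * (X i y * X j y) := fun y => by
    rw [sq, sum_mul_sum]
    exact sum_congr rfl fun i _ => sum_congr rfl fun j _ => by ring
  have hY : Integrable (fun y => ∑ i ∈ I, w i * X i y) ν :=
    integrable_finsetSum _ fun i _ => (hX i).const_mul _
  have hY2 : Integrable (fun y => (∑ i ∈ I, w i * X i y) ^ 2) ν := by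
    simp_rw [hsq]
    exact integrable_finsetSum _ fun i _ => integrable_finsetSum _ fun j _ =>
      (hXX i j).const_mul _
  have h1 : ∫ y, ∑ i ∈ I, w i * X i y ∂ν = μ := by
    rw [integral_finsetSum _ fun i _ => (hX i).const_mul _]
    exact sum_congr rfl fun i hi => by rw [integral_const_mul, hp i hi]
  -- Off the diagonal the pairs are uncorrelated; on it `X² = X` and `w² ≤ w`. With `μ ≤ 1` this
  -- gives `μ - (μ + μ²) / 4 ≥ μ / 2`.
  have h2 : ∫ y, (∑ i ∈ I, w i * X i y) ^ 2 ∂ν ≤ μ + μ ^ 2 := by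
    simp_rw [hsq]
    rw [integral_finsetSum _ fun i _ => integrable_finsetSum _ fun j _ => (hXX i j).const_mul _]
    calc _ ≤ ∑ i ∈ I, (w i * p i + ∑ j ∈ I, (w i * p i) * (w j * p j)) := by
          refine sum_le_sum fun i hi => ?_
          rw [integral_finsetSum _ fun j _ => (hXX i j).const_mul _]
          have hterm : ∀ j ∈ I, ∫ y, w i * w j * (X i y * X j y) ∂ν ≤
              (if j = i then w i * p i else 0) + (w i * p i) * (w j * p j) := fun j hj => by
            rw [integral_const_mul]
            split_ifs with hji
            · subst hji
              simp_rw [hidem, hp j hj]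
              nlinarith [mul_nonneg (mul_nonneg (hw0 j hj) (hp0 j hj)) (sub_nonneg.2 (hw1 j hj)),
                mul_self_nonneg (w j * p j)]
            · rw [hpp i hi j hj fun h => hji h.symm]
              exact le_of_eq (by ring)
          refine (sum_le_sum hterm).trans ?_
          rw [sum_add_distrib, sum_ite_eq' I i, if_pos hi]
      _ = μ + μ ^ 2 := by
          rw [sum_add_distrib, ← sum_mul_sum, sq]
  have h3 : ∫ y, (∑ i ∈ I, w i * X i y - (∑ i ∈ I, w i * X i y) ^ 2 / 4) ∂ν =
      μ - (∫ y, (∑ i ∈ I, w i * X i y) ^ 2 ∂ν) / 4 := by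
    rw [integral_sub hY (hY2.div_const 4), h1, integral_div]
  rw [h3]
  nlinarith

variable {V : Type} [Fintype V] [DecidableEq V] {G : SimpleGraph V} [DecidableRel G.Adj]
  (ports : PortNumbering G)

/-- The neighbor of `v` behind port `c`, and `v` itself if there is no such port. -/
def target (v : V) (c : ℕ) : V := if h : c < G.degree v then (ports v ⟨c, h⟩).1 else v

/-- The indicator of the event that `v` contacts a node in `A`. -/
def hit (v : V) (A : Finset V) (y : V → ℕ) : ℝ := if target ports v (y v) ∈ A then 1 else 0

/-- The set of informed nodes after a push-pull step with contacts `y`. -/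
def spread (S : Finset V) (y : V → ℕ) : Finset V :=
  {w | w ∈ S ∨ (∃ v ∈ S, target ports v (y v) = w) ∨ target ports w (y w) ∈ S}

variable (G) in
/-- The joint law of the contacts of all nodes. -/
def contactLaw : Measure (V → ℕ) := Measure.pi fun v => (portLaw (G.degree v)).toMeasure

instance : IsProbabilityMeasure (contactLaw G) := by
  unfold contactLaw
  infer_instance

theorem integrable_contactLaw {f : (V → ℕ) → ℝ} (C : ℝ) (hf : ∀ y, |f y| ≤ C) :
    Integrable f (contactLaw G) :=
  Integrable.of_bound Measurable.of_discrete.aestronglyMeasurable C (ae_of_all _ hf)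

theorem portLaw_real_target {v : V} (hd : 0 < G.degree v) (A : Finset V) :
    (portLaw (G.degree v)).toMeasure.real {c | target ports v c ∈ A} =
      degreeIn G v A / G.degree v := by
  classical
  rw [portLaw, dif_neg hd.ne', measureReal_def,
    PMF.toMeasure_uniformOfFinset_apply _ _ MeasurableSet.of_discrete, card_range,
    ENNReal.toReal_div, ENNReal.toReal_natCast, ENNReal.toReal_natCast]
  congr 1
  have h : degreeIn G v A = ∑ w, if w ∈ A ∧ G.Adj v w then 1 else 0 := by
    simp only [degreeIn, ite_and, sum_ite_mem, univ_inter]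
  rw [h, ← sum_ports ports v (fun w => if w ∈ A ∧ G.Adj v w then (1 : ℝ) else 0)
    fun w hw => if_neg fun h => hw h.2, card_filter, Nat.cast_sum, sum_range]
  refine sum_congr rfl fun i _ => ?_
  have ht : target ports v i = (ports v i).1 := dif_pos i.2
  simp only [Set.mem_ofPred_eq, ht, adj_ports ports v i, and_true]
  split_ifs <;> simp

theorem integral_hit {v : V} (hd : 0 < G.degree v) (A : Finset V) :
    ∫ y, hit ports v A y ∂contactLaw G = degreeIn G v A / G.degree v := by
  rw [← portLaw_real_target ports hd A, ← integral_indicator_one MeasurableSet.of_discrete,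
    contactLaw, ← integral_comp_eval (μ := fun v => (portLaw (G.degree v)).toMeasure) (i := v)
      Measurable.of_discrete.aestronglyMeasurable]
  refine integral_congr_ae (ae_of_all _ fun y => ?_)
  simp only [hit, Set.indicator_apply, Set.mem_ofPred_eq, Pi.one_apply]

theorem integral_hit_mul_hit {v w : V} (hvw : v ≠ w) (A B : Finset V) :
    ∫ y, hit ports v A y * hit ports w B y ∂contactLaw G =
      (∫ y, hit ports v A y ∂contactLaw G) * ∫ y, hit ports w B y ∂contactLaw G := by
  have h := (iIndepFun_pi (μ := fun v => (portLaw (G.degree v)).toMeasure)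
    (X := fun _ => (id : ℕ → ℕ)) fun _ => aemeasurable_id).indepFun hvw
  exact (h.comp (φ := fun c => if target ports v c ∈ A then (1 : ℝ) else 0)
    (ψ := fun c => if target ports w c ∈ B then (1 : ℝ) else 0) Measurable.of_discrete
    Measurable.of_discrete).integral_fun_mul_eq_mul_integral
    Measurable.of_discrete.aestronglyMeasurable Measurable.of_discrete.aestronglyMeasurable

theorem hit_mul_self (v : V) (A : Finset V) (y : V → ℕ) :
    hit ports v A y * hit ports v A y = hit ports v A y := by
  unfold hit
  split_ifs <;> norm_num

theorem hit_nonneg (v : V) (A : Finset V) (y : V → ℕ) : 0 ≤ hit ports v A y := by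
  unfold hit
  split_ifs <;> norm_num

theorem hit_le_one (v : V) (A : Finset V) (y : V → ℕ) : hit ports v A y ≤ 1 := by
  unfold hit
  split_ifs <;> norm_num

theorem subset_spread (S : Finset V) (y : V → ℕ) : S ⊆ spread ports S y := fun v hv => by
  simp [spread, hv]

variable (G) in
/-- The potential: the ratio of the volumes of the uninformed and of the informed nodes. -/
def ratio (S : Finset V) : ℝ := (vol G Sᶜ : ℝ) / vol G S

theorem ratio_nonneg (S : Finset V) : 0 ≤ ratio G S := by
  unfold ratio
  positivity

theorem ratio_anti {S S' : Finset V} (h : S ⊆ S') (hS : 0 < vol G S) :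
    ratio G S' ≤ ratio G S := by
  have h1 : vol G S ≤ vol G S' := vol_mono G h
  have h2 : vol G S'ᶜ ≤ vol G Sᶜ := vol_mono G (compl_subset_compl.2 h)
  unfold ratio
  gcongr

theorem ratio_add_one {S : Finset V} (hS : 0 < vol G S) :
    ratio G S + 1 = vol G univ / vol G S := by
  have : (0 : ℝ) < vol G S := by exact_mod_cast hS
  rw [ratio, ← vol_add_vol_compl G S]
  push_cast
  field_simp
  ring

theorem sum_degree_mul_hit_le (S T : Finset V) (hT : Disjoint T S) (y : V → ℕ) :
    ∑ v ∈ T, G.degree v * hit ports v S y ≤ (vol G (spread ports S y) : ℝ) - vol G S := by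
  have h1 : ∑ v ∈ T, G.degree v * hit ports v S y =
      (vol G (T.filter fun v => target ports v (y v) ∈ S) : ℝ) := by
    rw [cast_vol, sum_filter]
    exact sum_congr rfl fun v _ => by unfold hit; split_ifs <;> simp
  have h2 : vol G S + vol G (T.filter fun v => target ports v (y v) ∈ S) ≤
      vol G (spread ports S y) := by
    unfold vol
    rw [← sum_union (hT.symm.mono_right (filter_subset _ _))]
    refine sum_le_sum_of_subset (union_subset (subset_spread ports S y) fun v hv => ?_)
    simp only [mem_filter] at hv
    simp [spread, hv.2]
  have h3 : (vol G S : ℝ) + vol G (T.filter fun v => target ports v (y v) ∈ S) ≤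
      vol G (spread ports S y) := by exact_mod_cast h2
  rw [h1]
  linarith

/-- When most of the volume is informed, pulling reduces the rest. -/
theorem integral_ratio_spread_le_of_large (hG : G.Connected) (hV : 2 ≤ Fintype.card V)
    {S : Finset V} (hS : S.Nonempty) (hSc : Sᶜ.Nonempty) (hle : vol G Sᶜ ≤ vol G S) :
    ∫ y, ratio G (spread ports S y) ∂contactLaw G ≤ (1 - conductance G) * ratio G S := by
  have hd := degree_pos_of_connected hG hV
  have hB : (0 : ℝ) < vol G S := by exact_mod_cast vol_pos hG hV hS
  have hpt : ∀ y, ratio G (spread ports S y) ≤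
      (vol G Sᶜ - ∑ v ∈ Sᶜ, G.degree v * hit ports v S y) / vol G S := fun y => by
    have h1 := sum_degree_mul_hit_le ports S Sᶜ (disjoint_compl_left) y
    have h2 : (vol G (spread ports S y) : ℝ) + vol G (spread ports S y)ᶜ =
        vol G S + vol G Sᶜ := by
      exact_mod_cast (vol_add_vol_compl G _).trans (vol_add_vol_compl G S).symm
    have h3 : (vol G S : ℝ) ≤ vol G (spread ports S y) := by
      exact_mod_cast vol_mono G (subset_spread ports S y)
    calc ratio G (spread ports S y) ≤ vol G (spread ports S y)ᶜ / vol G S := by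
          unfold ratio; gcongr
      _ ≤ _ := by gcongr; linarith
  have hint : ∀ v, Integrable (fun y => G.degree v * hit ports v S y) (contactLaw G) := fun v =>
    (integrable_contactLaw 1 fun y => by
      rw [abs_of_nonneg (hit_nonneg ports v S y)]; exact hit_le_one ports v S y).const_mul _
  have hE : ∫ y, (vol G Sᶜ - ∑ v ∈ Sᶜ, G.degree v * hit ports v S y) / vol G S ∂contactLaw G =
      (vol G Sᶜ - cutSize G S) / vol G S := by
    rw [integral_div, integral_sub (integrable_const _) (integrable_finsetSum _ fun v _ => hint v),
      integral_finsetSum _ fun v _ => hint v, ← cutSize_compl, cutSize, compl_compl]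
    simp only [integral_const, probReal_univ, one_smul]
    congr 2
    refine sum_congr rfl fun v _ => ?_
    have : (0 : ℝ) < G.degree v := by exact_mod_cast hd v
    rw [integral_const_mul, integral_hit ports (hd v)]
    field_simp
  have hcut := conductance_mul_le_cutSize hG hV hS hSc
  rw [min_eq_right (by exact_mod_cast hle)] at hcut
  calc _ ≤ ∫ y, (vol G Sᶜ - ∑ v ∈ Sᶜ, G.degree v * hit ports v S y) / vol G S ∂contactLaw G :=
        integral_mono (integrable_contactLaw (ratio G S) fun y => by
          rw [abs_of_nonneg (ratio_nonneg _)]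
          exact ratio_anti (subset_spread ports S y) (vol_pos hG hV hS))
          (((integrable_const _).sub (integrable_finsetSum _ fun v _ => hint v)).div_const _) hpt
    _ ≤ (1 - conductance G) * ratio G S := by
      rw [hE, ratio, ← mul_div_assoc]
      gcongr
      linarith

/-- When at most half of the volume is informed, pushing reaches nodes of large degree and
pulling informs nodes of small degree. -/
theorem integral_ratio_spread_le_of_small (hG : G.Connected) (hV : 2 ≤ Fintype.card V)
    {S : Finset V} (hS : S.Nonempty) (hSc : Sᶜ.Nonempty) (hle : vol G S ≤ vol G Sᶜ) :
    ∫ y, ratio G (spread ports S y) ∂contactLaw G ≤ (1 - conductance G / 4) * ratio G S := by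
  have hd := degree_pos_of_connected hG hV
  have hdR : ∀ v, (0 : ℝ) < G.degree v := fun v => by exact_mod_cast hd v
  have hBN := vol_pos hG hV hS
  set B := vol G S with hBdef
  have hB : (0 : ℝ) < B := by exact_mod_cast hBN
  -- Informed nodes push towards `H`, the uninformed nodes of degree above `B`; the other uninformed
  -- nodes pull from `S`. The weights `d_v / B` of the nodes in `I` are at most 1, as the second
  -- moment bound demands.
  set H : Finset V := Sᶜ.filter fun w => B < G.degree w with hH
  set I : Finset V := univ.filter fun v => G.degree v ≤ B with hI
  let A : V → Finset V := fun v => if v ∈ S then H else S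
  let w : V → ℝ := fun v => G.degree v / B
  let p : V → ℝ := fun v => degreeIn G v (A v) / G.degree v
  have hSI : I.filter (fun v => v ∈ S) = S := by
    ext v
    simp only [hI, mem_filter, mem_univ, true_and, and_iff_right_iff_imp]
    exact fun hv => single_le_sum (f := fun v => G.degree v) (fun _ _ => Nat.zero_le _) hv
  have hSI' : I.filter (fun v => v ∉ S) = Sᶜ.filter fun v => ¬ B < G.degree v := by
    ext v
    simp [hI, and_comm]
  -- Each edge of the cut is counted once: from its end in `S` if the other end is in `H`, and from
  -- the other end if not.
  have hμ : ∑ v ∈ I, w v * p v = cutSize G S / B := by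
    have h1 : ∀ v, w v * p v = degreeIn G v (A v) / B := fun v => by
      have := hdR v
      simp only [w, p]
      field_simp
    simp_rw [h1]
    rw [← sum_div]
    congr 1
    rw [← sum_filter_add_sum_filter_not I (fun v => v ∈ S), hSI, hSI', ← cutSize_compl, cutSize,
      compl_compl, ← sum_filter_add_sum_filter_not Sᶜ (fun v => B < G.degree v)]
    congr 1
    · rw [← hH, ← sum_degreeIn_comm]
      exact sum_congr rfl fun v hv => by simp only [A, if_pos hv]
    · exact sum_congr rfl fun v hv => by
        simp only [A, if_neg (mem_compl.1 (mem_filter.1 hv).1)]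
  let X : V → (V → ℕ) → ℝ := fun v => hit ports v (A v)
  let Y : (V → ℕ) → ℝ := fun y => ∑ v ∈ I, w v * X v y
  have hXint : ∀ v, Integrable (X v) (contactLaw G) := fun v =>
    integrable_contactLaw 1 fun y => by
      rw [abs_of_nonneg (hit_nonneg ..)]; exact hit_le_one ..
  have hXXint : ∀ v u, Integrable (fun y => X v y * X u y) (contactLaw G) := fun v u =>
    integrable_contactLaw 1 fun y => by
      rw [abs_of_nonneg (mul_nonneg (hit_nonneg ..) (hit_nonneg ..))]
      exact mul_le_one₀ (hit_le_one ..) (hit_nonneg ..) (hit_le_one ..)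
  have hmean : (∑ v ∈ I, w v * p v) / 2 ≤ ∫ y, (Y y - Y y ^ 2 / 4) ∂contactLaw G :=
    half_le_integral_sub_sq I hXint hXXint (fun v y => hit_mul_self ..)
      (fun v _ => integral_hit ports (hd v) _)
      (fun v _ u _ hvu => by
        simp only [X, p]
        rw [integral_hit_mul_hit ports hvu, integral_hit ports (hd v) _,
          integral_hit ports (hd u) _])
      (fun v _ => div_nonneg (degreeIn_nonneg ..) (hdR v).le) (fun v _ => by positivity)
      (fun v hv => div_le_one_of_le₀ (by exact_mod_cast (mem_filter.1 hv).2) hB.le)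
      (by rw [hμ]; exact div_le_one_of_le₀ (cutSize_le_vol G S) hB.le)
  have hY0 : ∀ y, 0 ≤ Y y := fun y =>
    sum_nonneg fun v _ => mul_nonneg (by positivity) (hit_nonneg ..)
  have hYle : ∀ y, Y y ≤ ∑ v ∈ I, w v := fun y => sum_le_sum fun v _ =>
    mul_le_of_le_one_right (by positivity) (hit_le_one ..)
  have hpt : ∀ y, ratio G (spread ports S y) ≤
      ratio G S - vol G univ / B * ((Y y - Y y ^ 2 / 4) / 2) := fun y => by
    set Z := Y y - Y y ^ 2 / 4 with hZ
    have hsub : (B : ℝ) ≤ vol G (spread ports S y) := by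
      exact_mod_cast vol_mono G (subset_spread ports S y)
    set x : ℝ := (vol G (spread ports S y) - B) / B with hx
    have hx0 : 0 ≤ x := div_nonneg (by linarith) hB.le
    have hZ1 : Z ≤ 1 := by rw [hZ]; nlinarith [sq_nonneg (Y y / 2 - 1)]
    -- A successful push to `H` at least doubles the informed volume, so `x ≥ 1 ≥ Z`. Otherwise `Y`
    -- contains only pulls, and `Z ≤ Y ≤ x`.
    have hZx : Z ≤ x := by
      by_cases hpush : ∃ v ∈ S, target ports v (y v) ∈ H
      · obtain ⟨v, hv, hvH⟩ := hpush
        set u := target ports v (y v) with hu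
        have huH := mem_filter.1 hvH
        have h1 : vol G S + G.degree u ≤ vol G (spread ports S y) := by
          unfold vol
          rw [add_comm, ← sum_insert (f := fun v => G.degree v) (mem_compl.1 huH.1)]
          refine sum_le_sum_of_subset (insert_subset ?_ (subset_spread ports S y))
          simp only [spread, mem_filter, mem_univ, true_and]
          exact Or.inr (Or.inl ⟨v, hv, hu.symm⟩)
        have h2 : (B : ℝ) + B ≤ vol G (spread ports S y) := by
          exact_mod_cast (Nat.add_le_add_left huH.2.le _).trans h1
        refine hZ1.trans ?_
        rw [hx, le_div_iff₀ hB]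
        linarith
      · push Not at hpush
        have h1 : Y y ≤ x := by
          have h2 : Y y = (∑ v ∈ I.filter (fun v => v ∉ S), G.degree v * hit ports v S y) / B := by
            simp only [Y]
            rw [← sum_filter_add_sum_filter_not I (fun v => v ∈ S), sum_eq_zero, zero_add, sum_div]
            · refine sum_congr rfl fun v hv => ?_
              simp only [X, A, w, if_neg (mem_filter.1 hv).2]
              ring
            · intro v hv
              have hvS := (mem_filter.1 hv).2
              simp only [X, A, if_pos hvS, hit, if_neg (hpush v hvS), mul_zero]
          rw [h2, hx]
          gcongr
          exact sum_degree_mul_hit_le ports S _ (disjoint_left.2 fun v hv => (mem_filter.1 hv).2) y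
        nlinarith [sq_nonneg (Y y)]
    have hBx : (vol G (spread ports S y) : ℝ) = B * (1 + x) := by rw [hx]; field_simp; ring
    -- The loss `x / (1 + x)` is at least `x / 2` for `x ≤ 1` and at least `1 / 2` beyond; both
    -- dominate `Z / 2`.
    have h4 : 1 / (1 + x) ≤ 1 - Z / 2 := by
      rw [div_le_iff₀ (by linarith)]
      rcases le_total x 1 with h | h
      · nlinarith
      · nlinarith
    have h5 := ratio_add_one (G := G) (S := spread ports S y)
      (hBN.trans_le (vol_mono G (subset_spread ports S y)))
    have h6 := ratio_add_one (G := G) hBN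
    have h7 : (vol G univ : ℝ) / vol G (spread ports S y) = vol G univ / B * (1 / (1 + x)) := by
      rw [hBx]; field_simp
    have h8 : (vol G univ : ℝ) / B * (1 / (1 + x)) ≤ vol G univ / B * (1 - Z / 2) := by gcongr
    rw [← hBdef] at h6
    linarith
  have hYint : Integrable (fun y => Y y - Y y ^ 2 / 4) (contactLaw G) :=
    (integrable_contactLaw _ fun y => by rw [abs_of_nonneg (hY0 y)]; exact hYle y).sub
      ((integrable_contactLaw ((∑ v ∈ I, w v) ^ 2) fun y => by
        rw [abs_of_nonneg (sq_nonneg _)]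
        have := hY0 y
        have := hYle y
        gcongr).div_const 4)
  have hcut := conductance_mul_le_cutSize hG hV hS hSc
  rw [min_eq_left (by exact_mod_cast hle), ← le_div_iff₀ hB, ← hμ] at hcut
  have hN := ratio_add_one (G := G) hBN
  have hN0 : (0 : ℝ) ≤ vol G univ / B := by positivity
  have hφ := conductance_pos hG hV
  calc _ ≤ ∫ y, (ratio G S - vol G univ / B * ((Y y - Y y ^ 2 / 4) / 2)) ∂contactLaw G :=
        integral_mono (integrable_contactLaw (ratio G S) fun y => by
          rw [abs_of_nonneg (ratio_nonneg _)]
          exact ratio_anti (subset_spread ports S y) hBN)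
          ((integrable_const _).sub ((hYint.div_const 2).const_mul _)) hpt
    _ = ratio G S - vol G univ / B * ((∫ y, (Y y - Y y ^ 2 / 4) ∂contactLaw G) / 2) := by
      rw [integral_sub (integrable_const _) ((hYint.div_const 2).const_mul _),
        integral_const_mul, integral_div]
      simp
    _ ≤ ratio G S - vol G univ / B * (conductance G / 2 / 2) := by
      gcongr
      linarith
    _ ≤ (1 - conductance G / 4) * ratio G S := by
      rw [← hBdef] at hN
      rw [← hN]
      nlinarith

/-- The potential decreases in expectation in every push-pull step. -/
theorem integral_ratio_spread_le (hG : G.Connected) (hV : 2 ≤ Fintype.card V)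
    {S : Finset V} (hS : S.Nonempty) :
    ∫ y, ratio G (spread ports S y) ∂contactLaw G ≤ (1 - conductance G / 4) * ratio G S := by
  rcases Sᶜ.eq_empty_or_nonempty with h | h
  · have hu : S = univ := by simpa using h
    have h0 : ∀ y, ratio G (spread ports S y) = 0 := fun y => by
      have : spread ports S y = univ := univ_subset_iff.1 (hu ▸ subset_spread ports S y)
      simp [ratio, this, vol]
    simp only [h0, integral_zero]
    simp [ratio, h, vol]
  · rcases le_total (vol G S) (vol G Sᶜ) with hle | hle
    · exact integral_ratio_spread_le_of_small ports hG hV hS h hle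
    · refine (integral_ratio_spread_le_of_large ports hG hV hS h hle).trans ?_
      have := conductance_pos hG hV
      have := ratio_nonneg (G := G) S
      gcongr
      linarith

end Spread

/-! ### Independence of the coins of one round from the past. -/

section Resampling

open Finset MeasureTheory ProbabilityTheory

/-- Replacing one coordinate by an independent copy preserves an infinite product measure. -/
theorem measurePreserving_update_infinitePi {ι : Type*} [DecidableEq ι] {X : ι → Type*}
    [∀ i, MeasurableSpace (X i)] (μ : ∀ i, Measure (X i)) [∀ i, IsProbabilityMeasure (μ i)]
    (j : ι) :
    MeasurePreserving (fun z : (∀ i, X i) × X j => Function.update z.1 j z.2)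
      ((Measure.infinitePi μ).prod (μ j)) (Measure.infinitePi μ) := by
  have hm : Measurable (fun z : (∀ i, X i) × X j => Function.update z.1 j z.2) :=
    measurable_update'
  refine ⟨hm, Measure.eq_infinitePi μ fun s t ht => ?_⟩
  rw [Measure.map_apply hm (MeasurableSet.pi s.countable_toSet fun i _ => ht i)]
  by_cases hj : j ∈ s
  · have : (fun z : (∀ i, X i) × X j => Function.update z.1 j z.2) ⁻¹' (Set.pi s t) =
        (Set.pi (s.erase j : Finset ι) t) ×ˢ t j := by
      ext z
      simp only [Set.mem_preimage, Set.mem_pi, Set.mem_prod, mem_coe, mem_erase]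
      constructor
      · intro h
        exact ⟨fun i hi => by simpa [Function.update_of_ne hi.1] using h i hi.2,
          by simpa using h j hj⟩
      · intro h i hi
        rcases eq_or_ne i j with rfl | hij
        · simpa using h.2
        · simpa [Function.update_of_ne hij] using h.1 i ⟨hij, hi⟩
    rw [this, Measure.prod_prod, Measure.infinitePi_pi _ fun i _ => ht i,
      prod_erase_mul s _ hj]
  · have : (fun z : (∀ i, X i) × X j => Function.update z.1 j z.2) ⁻¹' (Set.pi s t) =
        (Set.pi s t) ×ˢ Set.univ := by
      ext z
      simp only [Set.mem_preimage, Set.mem_pi, Set.mem_prod, mem_coe, Set.mem_univ, and_true]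
      refine forall₂_congr fun i hi => ?_
      rw [Function.update_of_ne (ne_of_mem_of_not_mem hi hj)]
    rw [this, Measure.prod_prod, Measure.infinitePi_pi _ fun i _ => ht i, measure_univ, mul_one]

variable {V : Type} [Fintype V]

/-- The outcome in which the samples of round `j` are replaced by `y`. -/
def resample (ω : Protocol.Outcome V) (j : ℕ) (y : V → ℕ) : Protocol.Outcome V :=
  fun v => ((ω v).1, Function.update (ω v).2 j (y v))

/-- This replaces conditioning on the past: after resampling round `j`, Fubini's theorem allows
averaging over the new coins with the first `j` rounds held fixed. -/
theorem measurePreserving_resample (μ : V → Measure ℕ) [∀ v, IsProbabilityMeasure (μ v)]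
    (κ : V → Measure ℕ) [∀ v, IsProbabilityMeasure (κ v)] (j : ℕ) :
    MeasurePreserving (fun z : Protocol.Outcome V × (V → ℕ) => resample z.1 j z.2)
      ((Measure.pi fun v => (μ v).prod (Measure.infinitePi fun _ : ℕ => κ v)).prod
        (Measure.pi κ))
      (Measure.pi fun v => (μ v).prod (Measure.infinitePi fun _ : ℕ => κ v)) := by
  have h1 : ∀ v, MeasurePreserving
      (fun z : (ℕ × (ℕ → ℕ)) × ℕ => (z.1.1, Function.update z.1.2 j z.2))
      (((μ v).prod (Measure.infinitePi fun _ : ℕ => κ v)).prod (κ v))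
      ((μ v).prod (Measure.infinitePi fun _ : ℕ => κ v)) := fun v =>
    ((MeasurePreserving.id (μ v)).prod
      (measurePreserving_update_infinitePi (fun _ : ℕ => κ v) j)).comp
      (measurePreserving_prodAssoc _ _ _)
  have h2 := measurePreserving_pi _ _ h1
  have h3 := (measurePreserving_arrowProdEquivProdArrow (ℕ × (ℕ → ℕ)) ℕ V
    (fun v => (μ v).prod (Measure.infinitePi fun _ : ℕ => κ v)) κ).symm
  exact h2.comp h3

/-- A function of the ids and of finitely many samples is measurable. -/
theorem measurable_of_nonanticipating {β : Type*} [MeasurableSpace β]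
    (t : ℕ) (F : Protocol.Outcome V → β)
    (hF : ∀ ω ω', (∀ v, (ω v).1 = (ω' v).1) → (∀ v, ∀ j < t, (ω v).2 j = (ω' v).2 j) →
      F ω = F ω') : Measurable F := by
  let res : Protocol.Outcome V → (V → ℕ × (Fin t → ℕ)) := fun ω v => ((ω v).1, fun j => (ω v).2 j)
  let ext : (V → ℕ × (Fin t → ℕ)) → Protocol.Outcome V := fun x v =>
    ((x v).1, fun j => if h : j < t then (x v).2 ⟨j, h⟩ else 0)
  have hres : Measurable res := by
    refine measurable_pi_lambda _ fun v => Measurable.prodMk ?_ (measurable_pi_lambda _ fun j => ?_)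
    · exact measurable_fst.comp (measurable_pi_apply v)
    · exact (measurable_pi_apply (j : ℕ)).comp (measurable_snd.comp (measurable_pi_apply v))
  -- `F` factors through a countable discrete space, on which every map is measurable.
  have : F = (F ∘ ext) ∘ res := funext fun ω =>
    hF _ _ (fun _ => rfl) fun v j hj => by simp [ext, res, hj]
  rw [this]
  exact Measurable.of_discrete.comp hres

end Resampling

/-! ### Time until the largest id is known everywhere. -/

section Analysis

set_option linter.unusedSectionVars false

open Finset MeasureTheory ProbabilityTheory

variable {V : Type} [Fintype V] [DecidableEq V] {G : SimpleGraph V} [DecidableRel G.Adj]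
  (ports : PortNumbering G) {n L : ℕ} {c : Codec L}

theorem gossipRun_congr {ω ω' : Protocol.Outcome V} (h : ∀ v, (ω v).1 = (ω' v).1) {t : ℕ}
    (ht : ∀ v, ∀ j < t, (ω v).2 j = (ω' v).2 j) :
    gossipRun ports n c ω t = gossipRun ports n c ω' t := by
  induction t with
  | zero =>
    funext v
    change NodeState.initial _ = NodeState.initial _
    rw [h]
  | succ t ih =>
    have ih := ih fun v j hj => ht v j (Nat.lt_succ_of_lt hj)
    funext v
    change (gossip n c).step _ (gossipRun ports n c ω t v)
      ((gossip n c).inbox ports (gossipRun ports n c ω t) v) ((ω v).2 t) =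
      (gossip n c).step _ (gossipRun ports n c ω' t v)
      ((gossip n c).inbox ports (gossipRun ports n c ω' t) v) ((ω' v).2 t)
    rw [ih, ht v t (Nat.lt_succ_self t)]

/-- The ids are distinct and in the prescribed range. -/
def GoodIds (n : ℕ) (ω : Protocol.Outcome V) : Prop :=
  Function.Injective (fun v => (ω v).1) ∧ ∀ v, (ω v).1 ≤ n ^ 4

/-- The largest id. -/
def topId (ω : Protocol.Outcome V) : ℕ := univ.sup fun v => (ω v).1

theorem exists_lead [Nonempty V] (ω : Protocol.Outcome V) :
    ∃ l, (ω l).1 = topId ω ∧ ∀ v, (ω v).1 ≤ (ω l).1 := by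
  obtain ⟨l, -, hl⟩ := exists_mem_eq_sup univ univ_nonempty fun v => (ω v).1
  exact ⟨l, hl.symm, fun v => hl ▸ le_sup (f := fun v => (ω v).1) (mem_univ v)⟩

/-- The nodes that know the largest id after `t` rounds. -/
def informedAt (n : ℕ) (c : Codec L) (ω : Protocol.Outcome V) (t : ℕ) : Finset V :=
  informed (gossipRun ports n c ω t) (topId ω)

theorem isElection_gossipRun (hc : c.Faithful n) (hn : Fintype.card V = n)
    {ω : Protocol.Outcome V} (hω : GoodIds n ω) {l : V} (hl : ∀ v, (ω v).1 ≤ (ω l).1) :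
    IsElection ports n (fun v => (ω v).1) (fun v => (ω v).2) (gossipRun ports n c ω) l where
  toIsExecution := gossipRun_isExecution ports hc ω
  card_eq := hn
  inj := hω.1
  ident_le := hω.2
  le_lead := hl

theorem informedAt_nonempty (hc : c.Faithful n) (hn : Fintype.card V = n) (h2 : 2 ≤ n)
    {ω : Protocol.Outcome V} (hω : GoodIds n ω) (t : ℕ) :
    (informedAt ports n c ω t).Nonempty := by
  have : Nonempty V := Fintype.card_pos_iff.1 (by omega)
  obtain ⟨l, hl, hl'⟩ := exists_lead ω
  refine ⟨l, mem_informed.2 ?_⟩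
  rw [(isElection_gossipRun ports hc hn hω hl').best_lead, hl]

/-- This links the protocol to the abstract push-pull step: the contacts drawn in round `t` take
full effect by time `t + 3`. -/
theorem spread_subset_informedAt (hc : c.Faithful n) (hn : Fintype.card V = n) (h2 : 2 ≤ n)
    {ω : Protocol.Outcome V} (hω : GoodIds n ω) (t : ℕ) :
    spread ports (informedAt ports n c ω t) (fun v => (ω v).2 t) ⊆
      informedAt ports n c ω (t + 3) := by
  have : Nonempty V := Fintype.card_pos_iff.1 (by omega)
  obtain ⟨l, hl, hl'⟩ := exists_lead ω
  have hσ := isElection_gossipRun ports hc hn hω hl'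
  have key : ∀ v, (v ∈ informedAt ports n c ω t ∨
      target ports v ((ω v).2 t) ∈ informedAt ports n c ω t) →
      v ∈ informedAt ports n c ω (t + 3) ∧
      target ports v ((ω v).2 t) ∈ informedAt ports n c ω (t + 3) := fun v hv => by
    simp only [informedAt, mem_informed, ← hl] at hv ⊢
    unfold target at hv ⊢
    split_ifs at hv ⊢ with hlt
    · exact hσ.informed_of_contact (adj_ports ports v ⟨_, hlt⟩) (by rw [portTo_ports]) hv
    · have := hσ.best_persist (Nat.le_add_right t 3) (or_self_iff.1 hv)
      exact ⟨this, this⟩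
  intro w hw
  simp only [spread, mem_filter, mem_univ, true_and] at hw
  rcases hw with h | ⟨v, hv, rfl⟩ | h
  · exact (key w (Or.inl h)).1
  · exact (key v (Or.inl hv)).2
  · exact (key w (Or.inr h)).1

open Classical in
/-- The potential after `t` rounds. -/
def potential (n : ℕ) (c : Codec L) (t : ℕ) (ω : Protocol.Outcome V) : ENNReal :=
  if GoodIds n ω then ENNReal.ofReal (ratio G (informedAt ports n c ω t)) else 0

theorem potential_congr {ω ω' : Protocol.Outcome V} (h : ∀ v, (ω v).1 = (ω' v).1) {t : ℕ}
    (ht : ∀ v, ∀ j < t, (ω v).2 j = (ω' v).2 j) :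
    potential ports n c t ω = potential ports n c t ω' := by
  classical
  refine if_congr (by simp only [GoodIds, h]) ?_ rfl
  simp only [informedAt, topId, gossipRun_congr ports h ht, h]

theorem measurable_potential (t : ℕ) : Measurable (potential ports n c t) :=
  measurable_of_nonanticipating t _ fun _ _ h h' => potential_congr ports h h'

variable (G) in
theorem isProbabilityMeasure_ids (hV : 2 ≤ Fintype.card V) :
    IsProbabilityMeasure (uniformOn (Set.Icc 1 (Fintype.card V ^ 4))) :=
  isProbabilityMeasure_uniformOn (Set.finite_Icc _ _)
    (Set.nonempty_Icc.2 (Nat.one_le_pow _ _ (by omega)))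

/-- The set informed at time `t` and the ids do not depend on the coins of round `t`, so after
resampling these the one-step estimate applies to a fixed set; the coins of the two rounds in
between are not exploited. -/
theorem lintegral_potential_add_three_le (hc : c.Faithful n) (hn : Fintype.card V = n)
    (h2 : 2 ≤ n) (hG : G.Connected) (t : ℕ) :
    ∫⁻ ω, potential ports n c (t + 3) ω ∂(gossip n c).randomness G ≤
      ENNReal.ofReal (1 - conductance G / 4) *
        ∫⁻ ω, potential ports n c t ω ∂(gossip n c).randomness G := by
  have := isProbabilityMeasure_ids (V := V) (hn ▸ h2)
  have hpres := measurePreserving_resample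
    (fun _ : V => uniformOn (Set.Icc 1 (Fintype.card V ^ 4)))
    (fun v => (portLaw (G.degree v)).toMeasure) t
  have hm := measurable_potential ports (n := n) (c := c) (G := G)
  calc ∫⁻ ω, potential ports n c (t + 3) ω ∂(gossip n c).randomness G
      = ∫⁻ z, potential ports n c (t + 3) (resample z.1 t z.2)
          ∂((gossip n c).randomness G).prod (contactLaw G) :=
        (hpres.lintegral_comp (hm (t + 3))).symm
    _ = ∫⁻ ω, ∫⁻ y, potential ports n c (t + 3) (resample ω t y) ∂contactLaw G
          ∂(gossip n c).randomness G :=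
        lintegral_prod _ ((hm (t + 3)).comp hpres.measurable).aemeasurable
    _ ≤ ∫⁻ ω, ENNReal.ofReal (1 - conductance G / 4) * potential ports n c t ω
          ∂(gossip n c).randomness G := by
        refine lintegral_mono fun ω => ?_
        by_cases hω : GoodIds n ω
        · have hS := informedAt_nonempty ports hc hn h2 hω t
          have hpos := vol_pos hG (hn ▸ h2) hS
          have hstep : ∀ y, potential ports n c (t + 3) (resample ω t y) ≤
              ENNReal.ofReal (ratio G (spread ports (informedAt ports n c ω t) y)) := fun y => by
            have hω' : GoodIds n (resample ω t y) := hω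
            have hsame : informedAt ports n c (resample ω t y) t = informedAt ports n c ω t := by
              simp only [informedAt]
              rw [gossipRun_congr ports (ω := resample ω t y) (ω' := ω) (fun _ => rfl)
                fun v j hj => by simp [resample, hj.ne]]
              rfl
            have hsub := spread_subset_informedAt ports hc hn h2 hω' t
            rw [hsame] at hsub
            have hy : (fun v => (resample ω t y v).2 t) = y := by simp [resample]
            rw [hy] at hsub
            rw [potential, if_pos hω']
            exact ENNReal.ofReal_le_ofReal (ratio_anti hsub
              (hpos.trans_le (vol_mono G (subset_spread ports _ y))))
          calc _ ≤ ∫⁻ y, ENNReal.ofReal (ratio G (spread ports (informedAt ports n c ω t) y))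
                ∂contactLaw G := lintegral_mono hstep
            _ = ENNReal.ofReal (∫ y, ratio G (spread ports (informedAt ports n c ω t) y)
                ∂contactLaw G) := by
              rw [ofReal_integral_eq_lintegral_ofReal]
              · exact integrable_contactLaw (ratio G (informedAt ports n c ω t)) fun y => by
                  rw [abs_of_nonneg (ratio_nonneg _)]
                  exact ratio_anti (subset_spread ports _ y) hpos
              · exact ae_of_all _ fun y => ratio_nonneg _
            _ ≤ ENNReal.ofReal ((1 - conductance G / 4) * ratio G (informedAt ports n c ω t)) :=
              ENNReal.ofReal_le_ofReal (integral_ratio_spread_le ports hG (hn ▸ h2) hS)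
            _ = _ := by
              rw [ENNReal.ofReal_mul (by linarith [conductance_le_one (G := G) (hn ▸ h2)]),
                potential, if_pos hω]
        · have hω' : ∀ y, ¬ GoodIds n (resample ω t y) := fun y => hω
          simp [potential, hω, hω']
    _ = _ := lintegral_const_mul _ (hm t)

theorem lintegral_potential_le (hc : c.Faithful n) (hn : Fintype.card V = n)
    (h2 : 2 ≤ n) (hG : G.Connected) (k : ℕ) :
    ∫⁻ ω, potential ports n c (3 * k) ω ∂(gossip n c).randomness G ≤
      ENNReal.ofReal ((1 - conductance G / 4) ^ k * n ^ 2) := by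
  have h0 : 0 ≤ 1 - conductance G / 4 := by linarith [conductance_le_one (G := G) (hn ▸ h2)]
  induction k with
  | zero =>
    have := isProbabilityMeasure_ids (V := V) (hn ▸ h2)
    have : IsProbabilityMeasure ((gossip n c).randomness G) := by
      unfold Protocol.randomness
      infer_instance
    calc _ ≤ ∫⁻ _, ENNReal.ofReal (n ^ 2) ∂(gossip n c).randomness G := by
          refine lintegral_mono fun ω => ?_
          unfold potential
          split_ifs with hω
          · refine ENNReal.ofReal_le_ofReal ?_
            have hS := informedAt_nonempty ports hc hn h2 hω (3 * 0)
            have h1 : (1 : ℝ) ≤ vol G (informedAt ports n c ω (3 * 0)) := by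
              exact_mod_cast vol_pos hG (hn ▸ h2) hS
            have h3 : (vol G (informedAt ports n c ω (3 * 0))ᶜ : ℝ) ≤ n ^ 2 := by
              rw [← hn]
              exact_mod_cast (vol_mono G (subset_univ _)).trans (vol_univ_le G)
            exact (div_le_self (by positivity) h1).trans h3
          · exact zero_le
      _ = _ := by simp
  | succ k ih =>
    calc _ ≤ _ := lintegral_potential_add_three_le ports hc hn h2 hG (3 * k)
      _ ≤ ENNReal.ofReal (1 - conductance G / 4) *
          ENNReal.ofReal ((1 - conductance G / 4) ^ k * n ^ 2) := by gcongr
      _ = _ := by rw [← ENNReal.ofReal_mul h0, pow_succ']; congr 1; ring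

/-- The probability that the largest id has not reached all nodes. -/
theorem randomness_not_informed_le (hc : c.Faithful n) (hn : Fintype.card V = n)
    (h2 : 2 ≤ n) (hG : G.Connected) (k : ℕ) :
    (gossip n c).randomness G {ω | GoodIds n ω ∧ informedAt ports n c ω (3 * k) ≠ univ} ≤
      ENNReal.ofReal ((1 - conductance G / 4) ^ k * n ^ 4) := by
  have hn0 : (0 : ℝ) < n := by exact_mod_cast (by omega : 0 < n)
  -- An uninformed node has degree at least 1 and the informed volume is at most `n²`, so Markov's
  -- inequality is used at the level `1 / n²`.
  have hsub : {ω | GoodIds n ω ∧ informedAt ports n c ω (3 * k) ≠ univ} ⊆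
      {ω | ENNReal.ofReal (1 / n ^ 2) ≤ potential ports n c (3 * k) ω} := by
    rintro ω ⟨hω, hne⟩
    rw [Set.mem_ofPred_eq, potential, if_pos hω]
    refine ENNReal.ofReal_le_ofReal ?_
    have hS := informedAt_nonempty ports hc hn h2 hω (3 * k)
    have hSc : (informedAt ports n c ω (3 * k))ᶜ.Nonempty := by
      rw [nonempty_iff_ne_empty]
      simpa using hne
    have h1 : (1 : ℝ) ≤ vol G (informedAt ports n c ω (3 * k))ᶜ := by
      exact_mod_cast vol_pos hG (hn ▸ h2) hSc
    have h3 : (0 : ℝ) < vol G (informedAt ports n c ω (3 * k)) := by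
      exact_mod_cast vol_pos hG (hn ▸ h2) hS
    have h4 : (vol G (informedAt ports n c ω (3 * k)) : ℝ) ≤ n ^ 2 := by
      rw [← hn]
      exact_mod_cast (vol_mono G (subset_univ _)).trans (vol_univ_le G)
    unfold ratio
    gcongr
  have hmarkov := mul_meas_ge_le_lintegral (μ := (gossip n c).randomness G)
    (measurable_potential ports (n := n) (c := c) (3 * k)) (ENNReal.ofReal (1 / n ^ 2))
  have h1 : ENNReal.ofReal ((n : ℝ) ^ 2) * ENNReal.ofReal (1 / n ^ 2) = 1 := by
    rw [← ENNReal.ofReal_mul (by positivity), mul_one_div_cancel (by positivity),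
      ENNReal.ofReal_one]
  calc _ ≤ (gossip n c).randomness G
        {ω | ENNReal.ofReal (1 / n ^ 2) ≤ potential ports n c (3 * k) ω} := measure_mono hsub
    _ = ENNReal.ofReal ((n : ℝ) ^ 2) * (ENNReal.ofReal (1 / n ^ 2) * (gossip n c).randomness G
        {ω | ENNReal.ofReal (1 / n ^ 2) ≤ potential ports n c (3 * k) ω}) := by
      rw [← mul_assoc, h1, one_mul]
    _ ≤ ENNReal.ofReal ((n : ℝ) ^ 2) * ENNReal.ofReal ((1 - conductance G / 4) ^ k * n ^ 2) := by
      gcongr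
      exact hmarkov.trans (lintegral_potential_le ports hc hn h2 hG k)
    _ = _ := by
      rw [← ENNReal.ofReal_mul (by positivity)]
      congr 1
      ring

end Analysis

/-! ### Distinct ids, failure probability and the final bounds. -/

section Conclusion

set_option linter.unusedSectionVars false

open Finset MeasureTheory ProbabilityTheory

variable {V : Type} [Fintype V] [DecidableEq V] {G : SimpleGraph V} [DecidableRel G.Adj]
  (ports : PortNumbering G) {n L : ℕ} {c : Codec L}

theorem uniformOn_Icc_singleton_le (N k : ℕ) :
    uniformOn (Set.Icc 1 N) {k} ≤ (N : ENNReal)⁻¹ := by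
  rw [uniformOn, cond_apply measurableSet_Icc]
  have h1 : Measure.count (Set.Icc 1 N) = (N : ENNReal) := by
    rw [← coe_Icc, Measure.count_apply_finset, Nat.card_Icc, Nat.add_sub_cancel]
  have h2 : Measure.count (Set.Icc 1 N ∩ {k}) ≤ 1 :=
    (measure_mono Set.inter_subset_right).trans_eq (Measure.count_singleton k)
  rw [h1]
  exact (mul_le_mul_right h2 _).trans_eq (mul_one _)

variable (G) in
theorem randomness_ident (A : Protocol L) (hV : 2 ≤ Fintype.card V) (v : V) (B : Set ℕ) :
    A.randomness G {ω | (ω v).1 ∈ B} = uniformOn (Set.Icc 1 (Fintype.card V ^ 4)) B := by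
  have := isProbabilityMeasure_ids (V := V) hV
  have h := (measurePreserving_fst
    (μ := uniformOn (Set.Icc 1 (Fintype.card V ^ 4)))
    (ν := Measure.infinitePi fun _ : ℕ => (A.coin (G.degree v)).toMeasure)).comp
    (measurePreserving_eval (fun v : V => (uniformOn (Set.Icc 1 (Fintype.card V ^ 4))).prod
      (Measure.infinitePi fun _ : ℕ => (A.coin (G.degree v)).toMeasure)) v)
  exact h.measure_preimage MeasurableSet.of_discrete.nullMeasurableSet

variable (G) in
-- By independence each of the `N` common values has probability at most `N⁻²`. The range condition
-- makes the union over these values finite.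
theorem randomness_ident_eq_le (A : Protocol L) (hV : 2 ≤ Fintype.card V) {u v : V}
    (huv : u ≠ v) :
    A.randomness G {ω | (ω u).1 = (ω v).1 ∧ (ω u).1 ∈ Set.Icc 1 (Fintype.card V ^ 4)} ≤
      ((Fintype.card V ^ 4 : ℕ) : ENNReal)⁻¹ := by
  have := isProbabilityMeasure_ids (V := V) hV
  set N := Fintype.card V ^ 4 with hN
  have hN0 : (N : ENNReal) ≠ 0 := by
    rw [Nat.cast_ne_zero]
    positivity
  have hind := (iIndepFun_pi (μ := fun v : V => (uniformOn (Set.Icc 1 N)).prod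
      (Measure.infinitePi fun _ : ℕ => (A.coin (G.degree v)).toMeasure))
    (X := fun _ => (Prod.fst : ℕ × (ℕ → ℕ) → ℕ)) fun _ =>
      measurable_fst.aemeasurable).indepFun huv
  have hpair : ∀ k, A.randomness G ({ω | (ω u).1 ∈ ({k} : Set ℕ)} ∩
      {ω | (ω v).1 ∈ ({k} : Set ℕ)}) ≤ (N : ENNReal)⁻¹ * (N : ENNReal)⁻¹ := fun k => by
    have h := hind.measure_inter_preimage_eq_mul {k} {k} MeasurableSet.of_discrete
      MeasurableSet.of_discrete
    refine (le_of_eq h).trans (mul_le_mul' ?_ ?_)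
    · exact (randomness_ident G A hV u {k}).trans_le (uniformOn_Icc_singleton_le N k)
    · exact (randomness_ident G A hV v {k}).trans_le (uniformOn_Icc_singleton_le N k)
  calc _ ≤ A.randomness G (⋃ k ∈ Finset.Icc 1 N, ({ω | (ω u).1 ∈ ({k} : Set ℕ)} ∩
        {ω | (ω v).1 ∈ ({k} : Set ℕ)})) := by
        refine measure_mono fun ω hω => ?_
        simp only [Set.mem_iUnion]
        exact ⟨(ω u).1, Finset.mem_Icc.2 hω.2, rfl, hω.1.symm⟩
    _ ≤ ∑ k ∈ Finset.Icc 1 N, A.randomness G ({ω | (ω u).1 ∈ ({k} : Set ℕ)} ∩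
        {ω | (ω v).1 ∈ ({k} : Set ℕ)}) := measure_biUnion_finset_le _ _
    _ ≤ ∑ _k ∈ Finset.Icc 1 N, (N : ENNReal)⁻¹ * (N : ENNReal)⁻¹ := sum_le_sum fun k _ => hpair k
    _ = (N : ENNReal)⁻¹ := by
      rw [sum_const, Nat.card_Icc, Nat.add_sub_cancel, nsmul_eq_mul, ← mul_assoc,
        ENNReal.mul_inv_cancel hN0 (ENNReal.natCast_ne_top N), one_mul]

variable (G) in
/-- The probability that two ids coincide. -/
theorem randomness_not_goodIds_le (A : Protocol L) (hn : Fintype.card V = n) (h2 : 2 ≤ n) :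
    A.randomness G {ω | ¬ GoodIds n ω} ≤ ENNReal.ofReal (1 / n ^ 2) := by
  subst hn
  have hrange : ∀ v : V,
      A.randomness G {ω | (ω v).1 ∈ (Set.Icc 1 (Fintype.card V ^ 4))ᶜ} = 0 := fun v => by
    rw [randomness_ident G A h2, uniformOn_eq_zero_iff (Set.finite_Icc _ _), Set.inter_compl_self]
  have hn0 : (0 : ℝ) < Fintype.card V := by exact_mod_cast (by omega : 0 < Fintype.card V)
  calc _ ≤ A.randomness G ((⋃ v, {ω | (ω v).1 ∈ (Set.Icc 1 (Fintype.card V ^ 4))ᶜ}) ∪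
        ⋃ p ∈ (univ.filter fun p : V × V => p.1 ≠ p.2),
          {ω | (ω p.1).1 = (ω p.2).1 ∧ (ω p.1).1 ∈ Set.Icc 1 (Fintype.card V ^ 4)}) := by
        refine measure_mono fun ω hω => ?_
        by_contra hcon
        simp only [Set.mem_union, Set.mem_iUnion, not_or, not_exists] at hcon
        have hmem : ∀ v, (ω v).1 ∈ Set.Icc 1 (Fintype.card V ^ 4) := fun v =>
          not_not.1 (hcon.1 v)
        refine hω ⟨fun u v huv => ?_, fun v => (hmem v).2⟩
        by_contra hne
        exact hcon.2 (u, v) (by simpa using hne) ⟨huv, hmem u⟩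
    _ ≤ 0 + ∑ _p ∈ (univ.filter fun p : V × V => p.1 ≠ p.2),
          ((Fintype.card V ^ 4 : ℕ) : ENNReal)⁻¹ := by
        refine (measure_union_le _ _).trans (add_le_add (le_of_eq (measure_iUnion_null hrange)) ?_)
        refine (measure_biUnion_finset_le _ _).trans (sum_le_sum fun p hp => ?_)
        exact randomness_ident_eq_le G A h2 (by simpa using hp)
    _ ≤ ((Fintype.card V ^ 2 : ℕ) : ENNReal) * ((Fintype.card V ^ 4 : ℕ) : ENNReal)⁻¹ := by
        rw [zero_add, sum_const, nsmul_eq_mul]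
        gcongr
        refine (card_le_univ _).trans_eq ?_
        rw [Fintype.card_prod, sq]
    _ = ENNReal.ofReal (1 / (Fintype.card V : ℝ) ^ 2) := by
        rw [← ENNReal.ofReal_natCast, ← ENNReal.ofReal_natCast,
          ← ENNReal.ofReal_inv_of_pos (by push_cast; positivity),
          ← ENNReal.ofReal_mul (by positivity)]
        congr 1
        push_cast
        field_simp

theorem messages_gossip (ω : Protocol.Outcome V) (t : ℕ) :
    (gossip n c).messages ports ω t =
      ∑ v, #{i : Fin (G.degree v) | ((gossipRun ports n c ω t v).packet n i).isSome} := by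
  refine sum_congr rfl fun v _ => ?_
  congr 1
  refine filter_congr fun i _ => ?_
  change (Option.map c.enc ((gossipRun ports n c ω t v).packet n i)).isSome = true ↔ _
  rw [Option.isSome_map]

theorem solvesExplicit_gossip (hc : c.Faithful n) (hn : Fintype.card V = n) (h2 : 2 ≤ n)
    {ω : Protocol.Outcome V} (hω : GoodIds n ω) {t₀ : ℕ}
    (hall : informedAt ports n c ω t₀ = univ) {T : ℕ} (hT : 4 * t₀ + 2 ≤ T) :
    (gossip n c).SolvesExplicit ports ω T := by
  have : Nonempty V := Fintype.card_pos_iff.1 (by omega)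
  obtain ⟨l, hl, hl'⟩ := exists_lead ω
  have hσ := isElection_gossipRun ports hc hn hω hl'
  have hall' : ∀ v, (gossipRun ports n c ω t₀ v).best = (ω l).1 := fun v => by
    rw [hl]
    exact mem_informed.1 (hall.ge (mem_univ v))
  refine ⟨⟨l, fun v hv => hω.1 hv, fun t ht => ?_, fun v hv t => ?_, fun v t ht => ?_⟩,
    fun t ht => ?_⟩
  · change ((gossipRun ports n c ω t l).done && (gossipRun ports n c ω t l).parent.isNone) = true
    rw [hσ.all_done hall' (by omega), hσ.parent_lead]
    rfl
  · change ((gossipRun ports n c ω t v).done && (gossipRun ports n c ω t v).parent.isNone) = false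
    by_contra hcon
    simp only [Bool.not_eq_false, Bool.and_eq_true, Option.isNone_iff_eq_none] at hcon
    exact hv (hσ.eq_lead_of_parent_eq_none ((hσ.of_done hcon.1).2 v) hcon.2)
  · change some (gossipRun ports n c ω t v).best = some (ω l).1
    rw [hσ.best_persist (by omega : t₀ ≤ t) (hall' v)]
  · rw [messages_gossip]
    refine sum_eq_zero fun v _ => ?_
    rw [card_eq_zero, filter_eq_empty_iff]
    intro i _
    rw [hσ.packet_eq_none hall' (by omega)]
    simp

theorem sum_messages_gossip_le (hc : c.Faithful n) (hn : Fintype.card V = n)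
    {ω : Protocol.Outcome V} {T : ℕ} (hT : (gossip n c).SolvesExplicit ports ω T) (R : ℕ) :
    ∑ t ∈ range R, (gossip n c).messages ports ω t ≤ 4 * n * T := by
  calc ∑ t ∈ range R, (gossip n c).messages ports ω t
      ≤ ∑ t ∈ range R, if t < T then 4 * n else 0 := by
        refine sum_le_sum fun t _ => ?_
        split_ifs with h
        · rw [messages_gossip]
          exact hn ▸ (gossipRun_isExecution ports hc ω).sum_card_packet_le t
        · rw [hT.2 t (not_lt.1 h)]
    _ = ∑ t ∈ (range R).filter (· < T), 4 * n := (sum_filter _ _).symm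
    _ ≤ ∑ t ∈ range T, 4 * n := sum_le_sum_of_subset fun t ht =>
        mem_range.2 (mem_filter.1 ht).2
    _ = 4 * n * T := by simp [mul_comm]

/-- The failure probability of the gossip protocol. -/
theorem randomness_gossip_le (hc : c.Faithful n) (hn : Fintype.card V = n) (h2 : 2 ≤ n)
    (hG : G.Connected) {k : ℕ} (hk : 24 * Real.log n ≤ k * conductance G) :
    (gossip n c).randomness G
      {ω | ¬ (GoodIds n ω ∧ informedAt ports n c ω (3 * k) = univ)} ≤ (n : ENNReal)⁻¹ := by
  have hn0 : (0 : ℝ) < n := by exact_mod_cast (by omega : 0 < n)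
  have hn2 : (2 : ℝ) ≤ n := by exact_mod_cast h2
  have hexp : (1 - conductance G / 4) ^ k * (n : ℝ) ^ 4 ≤ 1 / n ^ 2 := by
    have h0 : 0 ≤ 1 - conductance G / 4 := by linarith [conductance_le_one (G := G) (hn ▸ h2)]
    -- The choice `k φ ≥ 24 log n` yields `n⁻⁶`, of which Markov's inequality and the initial
    -- potential consume `n⁴`.
    have h1 : (1 - conductance G / 4) ^ k ≤ 1 / (n : ℝ) ^ 6 := by
      calc (1 - conductance G / 4) ^ k ≤ Real.exp (-(conductance G / 4)) ^ k := by
            gcongr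
            linarith [Real.add_one_le_exp (-(conductance G / 4))]
        _ = Real.exp (-(k * conductance G / 4)) := by rw [← Real.exp_nat_mul]; congr 1; ring
        _ ≤ Real.exp (-(6 * Real.log n)) := Real.exp_le_exp.2 (by linarith)
        _ = 1 / (n : ℝ) ^ 6 := by
          rw [Real.exp_neg, one_div, show (6 : ℝ) * Real.log n = (6 : ℕ) * Real.log n by norm_num,
            Real.exp_nat_mul, Real.exp_log hn0]
    calc _ ≤ 1 / (n : ℝ) ^ 6 * (n : ℝ) ^ 4 := by gcongr
      _ = 1 / n ^ 2 := by field_simp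
  have hhalf : (1 : ℝ) / n ^ 2 + 1 / n ^ 2 ≤ 1 / n := by
    rw [← add_div, div_le_div_iff₀ (by positivity) hn0]
    nlinarith
  calc _ ≤ (gossip n c).randomness G ({ω | ¬ GoodIds n ω} ∪
        {ω | GoodIds n ω ∧ informedAt ports n c ω (3 * k) ≠ univ}) := by
        refine measure_mono fun ω hω => ?_
        by_cases h : GoodIds n ω
        · exact Or.inr ⟨h, fun h' => hω ⟨h, h'⟩⟩
        · exact Or.inl h
    _ ≤ ENNReal.ofReal (1 / n ^ 2) + ENNReal.ofReal (1 / n ^ 2) :=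
        (measure_union_le _ _).trans (add_le_add (randomness_not_goodIds_le G _ hn h2)
          ((randomness_not_informed_le ports hc hn h2 hG k).trans
            (ENNReal.ofReal_le_ofReal hexp)))
    _ ≤ ENNReal.ofReal (1 / n) := by
        rw [← ENNReal.ofReal_add (by positivity) (by positivity)]
        exact ENNReal.ofReal_le_ofReal hhalf
    _ = (n : ENNReal)⁻¹ := by
        rw [one_div, ENNReal.ofReal_inv_of_pos hn0, ENNReal.ofReal_natCast]

end Conclusion

end LeaderElection

end

theorem mainTheorem2 :
    ∃ (b : ℕ) (C : ℝ) (A : (n : ℕ) → LeaderElection.Protocol (b * Nat.clog 2 n)),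
      ∀ (V : Type) [Fintype V] [DecidableEq V] (G : SimpleGraph V) [DecidableRel G.Adj]
        (ports : LeaderElection.PortNumbering G) (n : ℕ),
        Fintype.card V = n → 2 ≤ n → G.Connected →
        (A n).randomness G
          {ω | ¬ ((A n).SolvesExplicit ports ω
                ⌊C * LeaderElection.mixingTime G * Real.log n ^ 2⌋₊ ∧
              ∀ R : ℕ, ((∑ t ∈ Finset.range R, (A n).messages ports ω t : ℕ) : ℝ) ≤
                C * (√n * Real.log n ^ (7 / 2 : ℝ) * LeaderElection.mixingTime G +
                  n * Real.log n / LeaderElection.conductance G))} ≤ (n : ENNReal)⁻¹ := by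
  -- The protocol must exist for every `n`; below 2 a dummy code serves.
  have hcodec : ∀ n : ℕ, ∃ c : LeaderElection.Codec (10 * Nat.clog 2 n), 2 ≤ n → c.Faithful n :=
    fun n => by
      by_cases h : 2 ≤ n
      · obtain ⟨c, hc⟩ := LeaderElection.exists_codec h
        exact ⟨c, fun _ => hc⟩
      · exact ⟨⟨fun _ _ => false, fun _ => ⟨0, 0, false, false⟩⟩, fun h' => absurd h' h⟩
  choose c hc using hcodec
  -- `2528 = 316 * 8`: the run takes at most `316 log n / φ` rounds, and `log n / φ ≤ 8 t_mix log²
  -- n`. The messages need only `4 * 316 = 1264`.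
  refine ⟨10, 2528, fun n => LeaderElection.gossip n (c n), ?_⟩
  intro V _ _ G _ ports n hn h2 hG
  have hφ := LeaderElection.conductance_pos hG (hn ▸ h2)
  have hφ1 := LeaderElection.conductance_le_one (G := G) (hn ▸ h2)
  have hmix := LeaderElection.one_le_mixingTime_mul_conductance hG (hn ▸ h2)
  set φ := LeaderElection.conductance G
  set τ : ℝ := (LeaderElection.mixingTime G : ℝ)
  have hlog : 1 / 2 ≤ Real.log n := by
    have : Real.log 2 ≤ Real.log n := Real.log_le_log (by norm_num) (by exact_mod_cast h2)
    linarith [Real.log_two_gt_d9]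
  have hn0 : (0 : ℝ) ≤ n := Nat.cast_nonneg n
  set k := ⌈24 * Real.log n / φ⌉₊ with hkdef
  have hk : 24 * Real.log n ≤ k * φ := (div_le_iff₀ hφ).1 (Nat.le_ceil _)
  have hk' : (k : ℝ) ≤ 24 * Real.log n / φ + 1 := (Nat.ceil_lt_add_one (by positivity)).le
  -- `12 k + 2 ≤ 288 log n / φ + 14`, and `14 ≤ 28 log n / φ` because `log n ≥ 1/2` and `φ ≤ 1`.
  have hT : ((4 * (3 * k) + 2 : ℕ) : ℝ) ≤ 316 * (Real.log n / φ) := by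
    have : Real.log n ≤ Real.log n / φ := le_div_self (by linarith) hφ hφ1
    push_cast
    rw [mul_div_assoc] at hk'
    linarith
  have hτ : Real.log n / φ ≤ 8 * τ * Real.log n ^ 2 := by
    rw [div_le_iff₀ hφ]
    nlinarith [mul_le_mul_of_nonneg_left hmix (by linarith : 0 ≤ Real.log n),
      mul_le_mul_of_nonneg_right hlog (by positivity : 0 ≤ 8 * τ * φ * Real.log n)]
  refine (MeasureTheory.measure_mono ?_).trans
    (LeaderElection.randomness_gossip_le ports (hc n h2) hn h2 hG hk)
  intro ω hω hgood
  refine hω ⟨LeaderElection.solvesExplicit_gossip ports (hc n h2) hn h2 hgood.1 hgood.2 ?_,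
    fun R => ?_⟩
  · refine Nat.le_floor (hT.trans ?_)
    linarith
  · have h1 := LeaderElection.sum_messages_gossip_le ports (hc n h2) hn
      (LeaderElection.solvesExplicit_gossip ports (hc n h2) hn h2 hgood.1 hgood.2 le_rfl) R
    -- Only the sign of this term matters; the other term carries the whole message bound.
    have h3 : (0 : ℝ) ≤ √n * Real.log n ^ (7 / 2 : ℝ) * τ := by
      have : 0 ≤ Real.log n := by linarith
      positivity
    have h4 : (0 : ℝ) ≤ n * Real.log n / φ := by
      have : 0 ≤ Real.log n := by linarith
      positivity
    calc _ ≤ ((4 * n * (4 * (3 * k) + 2) : ℕ) : ℝ) := by exact_mod_cast h1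
      _ = 4 * n * ((4 * (3 * k) + 2 : ℕ) : ℝ) := by push_cast; ring
      _ ≤ 4 * n * (316 * (Real.log n / φ)) := by gcongr
      _ = 1264 * (n * Real.log n / φ) := by ring
      _ ≤ _ := by linarith
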